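/- All logarithms are to base $2$. For a graph $G$ and $X\subseteq V(G)$, let $N_G(X)$ be the set of vertices outside $X$ that have at least one neighbour in $X$. An $n$-vertex graph $G$ is an $(\varepsilon,c,s)$-expander if for all $U\subseteq V(G)$ and $F\subseteq E(G)$ with $1\le |U|\le \frac23 n$ and $|F|\le s|U|$ one has $|N_{G-F}(U)|\ge \frac{\varepsilon}{(\log n)^c}|U|$. **Lemma.** There is an absolute constant $n_0$ such that the following holds. Let $2^{-9}\le\varepsilon<1$, $c>0$, $0<q<1$, $n\ge n_0$ and $s\ge \frac{2(\log n)^{9c+21}}{q^{10}}$. Let $G$ be an $n$-vertex $(\varepsilon,c,s)$-expander, and let $V$ be a random subset of $V(G)$ obtained by including each vertex independently with probability $q$. Then, with probability at least $1-\frac1n$, the following holds for every $r\ge 0$ simultaneously. If $x_1,\dots,x_r,y_1,\dots,y_r$ are (pairwise) distinct vertices not contained in $V$ such that $$|N_G(X)|\ge \frac{100(\log n)^{7c+19}}{q^6}\,|X|\qquad\text{for every } X\subseteq\{x_1,\dots,x_r,y_1,\dots,y_r\},$$ then there are paths $P_1,\dots,P_r$ in $G$, each of length at most $(\log n)^{c+4}$,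 such that for each $i$ the path $P_i$ goes from $x_i$ to $y_i$ and has all its internal vertices in $V$, and $P_1,\dots,P_r$ are pairwise vertex-disjoint. -/

import Mathlib

namespace SublinearExpander

/-- `N_G(U)`: the vertices outside `U` that are adjacent to at least one vertex of `U`. -/
def outerNeighbors {W : Type*} (G : SimpleGraph W) (U : Set W) : Set W :=
  {v | v ∉ U ∧ ∃ u ∈ U, G.Adj u v}

/-- `(ε, c, s)`-expander; the logarithm is to base 2, and `G.deleteEdges F` is `G - F`. -/
def IsExpander {W : Type*} [Fintype W] (G : SimpleGraph W) (ε c s : ℝ) : Prop :=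
  ∀ (U : Set W) (F : Set (Sym2 W)), F ⊆ G.edgeSet →
    1 ≤ U.ncard → (U.ncard : ℝ) ≤ 2 / 3 * (Fintype.card W : ℝ) →
    (F.ncard : ℝ) ≤ s * (U.ncard : ℝ) →
    ε / (Real.logb 2 (Fintype.card W : ℝ)) ^ c * (U.ncard : ℝ) ≤
      ((outerNeighbors (G.deleteEdges F) U).ncard : ℝ)

/-- `x i` and `y i`, for all `i < r`, can be joined by pairwise vertex-disjoint paths of length at
most `L` all of whose internal vertices lie in `V`. -/
def JoinedThrough {W : Type*} (G : SimpleGraph W) (V : Set W) (L : ℝ) {r : ℕ}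
    (x y : Fin r → W) : Prop :=
  ∃ P : ∀ i : Fin r, G.Walk (x i) (y i),
    (∀ i, (P i).IsPath) ∧
    (∀ i, ((P i).length : ℝ) ≤ L) ∧
    (∀ i, ∀ v ∈ (P i).support, v ≠ x i → v ≠ y i → v ∈ V) ∧
    (∀ i j, i ≠ j → ∀ v ∈ (P i).support, v ∉ (P j).support)

end SublinearExpander

namespace SublinearExpander

open Finset

/-! Write the random set as a union of M independent p-random sets, where (1 - p)^M = 1 - q, and
reveal them one at a time. The set reached from X in k rounds while avoiding Z depends only on what
has been revealed, so the next random set is fresh for it. By expansion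
(`exists_bounded_degree_edges`) and a bounded differences inequality, one round enlarges a reached
set of size between D(|X| + |Z| + 1) and 2n/3 by a factor 1 + η/2, except with probability at most
y^(|X| + |Z| + 1), where y ≤ n^(-3). This pays for a union bound over all X and Z. So with high
probability every round is a `GoodStep`, for all terminals and all forbidden sets at once, and the
rest is deterministic.

A single terminal may have too few neighbours to get around Z, whose size is allowed to be
proportional to |S|, where S is a set of indices. But the terminals of any half of S jointly have
enough neighbours, so together they reach more than 2n/3 vertices, and repeated bisection leaves one
terminal that does so alone (`exists_singleton_reach`). Hence fewer than half of S fail on the x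
side and fewer than half on the y side. Some i succeeds on both, and the last random set meets the
overlap. This gives `GoodChain.exists_path`.

Disjointness comes from Haxell's theorem. The class of i consists of the short paths from x i to y i
through V, and two paths conflict if they share a vertex of V. Any 2(|S| - 1) paths cover at most
6M|S| vertices of V, and some path in a class of S avoids all of these. -/

/-- The expectation of `f V`, where `V` is the random subset of `T` that contains each element
independently with probability `p`. -/
noncomputable def bernExp {W : Type*} [DecidableEq W] (p : ℝ) (T : Finset W)
    (f : Finset W → ℝ) : ℝ :=
  ∑ V ∈ T.powerset, p ^ #V * (1 - p) ^ #(T \ V) * f V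

/-! ### Random subsets: conditioning, unions and concentration. -/

section BernExp

variable {W : Type*} [DecidableEq W] {p : ℝ} {T : Finset W} {f g : Finset W → ℝ}

lemma bernExp_empty : bernExp p (∅ : Finset W) f = f ∅ := by
  simp [bernExp]

lemma bernExp_insert {a : W} (ha : a ∉ T) :
    bernExp p (insert a T) f =
      (1 - p) * bernExp p T f + p * bernExp p T (fun V => f (insert a V)) := by
  unfold bernExp
  rw [sum_powerset_insert ha, mul_sum, mul_sum]
  congr 1
  · refine sum_congr rfl fun V hV => ?_
    have haV : a ∉ V := fun h => ha (mem_powerset.1 hV h)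
    rw [insert_sdiff_of_notMem _ haV, card_insert_of_notMem (by simp [ha])]
    ring
  · refine sum_congr rfl fun V hV => ?_
    have haV : a ∉ V := fun h => ha (mem_powerset.1 hV h)
    rw [card_insert_of_notMem haV, insert_sdiff_insert, sdiff_insert_of_notMem ha]
    ring

lemma bernExp_const (p : ℝ) (T : Finset W) (c : ℝ) : bernExp p T (fun _ => c) = c := by
  induction T using Finset.induction_on with
  | empty => exact bernExp_empty
  | insert a T ha ih => rw [bernExp_insert ha, ih]; ring

lemma bernExp_mono (h0 : 0 ≤ p) (h1 : p ≤ 1) (h : ∀ V, f V ≤ g V) :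
    bernExp p T f ≤ bernExp p T g := by
  have : 0 ≤ 1 - p := by linarith
  exact sum_le_sum fun V _ => mul_le_mul_of_nonneg_left (h V) (by positivity)

lemma bernExp_mul_left (c : ℝ) : bernExp p T (fun V => c * f V) = c * bernExp p T f := by
  unfold bernExp
  rw [mul_sum]
  exact sum_congr rfl fun V _ => by ring

lemma bernExp_add : bernExp p T (fun V => f V + g V) = bernExp p T f + bernExp p T g := by
  unfold bernExp
  rw [← sum_add_distrib]
  exact sum_congr rfl fun V _ => by ring

lemma bernExp_sub : bernExp p T (fun V => f V - g V) = bernExp p T f - bernExp p T g := by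
  unfold bernExp
  rw [← sum_sub_distrib]
  exact sum_congr rfl fun V _ => by ring

lemma bernExp_sum {ι : Type*} (s : Finset ι) (F : ι → Finset W → ℝ) :
    bernExp p T (fun V => ∑ i ∈ s, F i V) = ∑ i ∈ s, bernExp p T (F i) := by
  unfold bernExp
  rw [sum_comm]
  exact sum_congr rfl fun V _ => by rw [mul_sum]

/-- The union of two independent random subsets is a random subset. -/
lemma bernExp_union {a b : ℝ} (h : 1 - p = (1 - a) * (1 - b)) (f : Finset W → ℝ) :
    bernExp p T f = bernExp a T (fun A => bernExp b T (fun B => f (A ∪ B))) := by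
  induction T using Finset.induction_on generalizing f with
  | empty => simp [bernExp_empty]
  | insert w T hw ih =>
    have hp : p = 1 - (1 - a) * (1 - b) := by linarith
    simp only [bernExp_insert hw, bernExp_add, bernExp_mul_left]
    simp only [union_insert, insert_union, insert_idem]
    rw [ih f, ih (fun V => f (insert w V)), hp]
    ring

/-- The one-coordinate case of the moment bound: expand exp(y - x) to second order, which is
legitimate for a difference of at most 1, then use 1 + z ≤ exp z. -/
lemma two_point_exp_le {p x y : ℝ} (h0 : 0 ≤ p) (h1 : p ≤ 1) (hxy : |y - x| ≤ 1) :
    (1 - p) * Real.exp x + p * Real.exp y ≤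
      Real.exp ((1 - p) * x + p * y + (y - x) ^ 2) := by
  have h2 := (abs_le.1 (Real.abs_exp_sub_one_sub_id_le hxy)).2
  have h3 := Real.add_one_le_exp (p * (y - x) + (y - x) ^ 2)
  have h4 : Real.exp y = Real.exp x * Real.exp (y - x) := by rw [← Real.exp_add]; ring_nf
  have h5 : Real.exp ((1 - p) * x + p * y + (y - x) ^ 2) =
      Real.exp x * Real.exp (p * (y - x) + (y - x) ^ 2) := by rw [← Real.exp_add]; ring_nf
  rw [h4, h5]
  have h6 : (1 - p) + p * Real.exp (y - x) ≤ Real.exp (p * (y - x) + (y - x) ^ 2) := by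
    nlinarith [mul_le_mul_of_nonneg_left h2 h0, sq_nonneg (y - x)]
  nlinarith [mul_le_mul_of_nonneg_left h6 (Real.exp_pos x).le]

/-- A bounded differences inequality for the moment generating function. -/
lemma bernExp_exp_le (h0 : 0 ≤ p) (h1 : p ≤ 1) (c : W → ℝ) (hc : ∀ a, c a ≤ 1)
    (f : Finset W → ℝ) (hf : ∀ a V, |f (insert a V) - f V| ≤ c a) :
    bernExp p T (fun V => Real.exp (f V)) ≤
      Real.exp (bernExp p T f + ∑ a ∈ T, c a ^ 2) := by
  induction T using Finset.induction_on generalizing f with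
  | empty => simp [bernExp_empty]
  | insert w T hw ih =>
    have hq : 0 ≤ 1 - p := by linarith
    have e1 := ih f hf
    have e2 := ih (fun V => f (insert w V)) (fun a V => by
      rw [insert_comm]; exact hf a (insert w V))
    have e3 : |bernExp p T (fun V => f (insert w V)) - bernExp p T f| ≤ c w := by
      rw [← bernExp_sub, abs_le]
      constructor
      · rw [← bernExp_const p T (-(c w))]
        exact bernExp_mono h0 h1 fun V => (abs_le.1 (hf w V)).1
      · rw [← bernExp_const p T (c w)]
        exact bernExp_mono h0 h1 fun V => (abs_le.1 (hf w V)).2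
    rw [bernExp_insert hw, bernExp_insert hw, sum_insert hw]
    set x := bernExp p T f
    set y := bernExp p T (fun V => f (insert w V))
    have e4 := two_point_exp_le h0 h1 (e3.trans (hc w))
    have e5 : (y - x) ^ 2 ≤ c w ^ 2 := by
      rw [← sq_abs]; exact pow_le_pow_left₀ (abs_nonneg _) e3 2
    calc _ ≤ (1 - p) * Real.exp (x + ∑ a ∈ T, c a ^ 2) +
          p * Real.exp (y + ∑ a ∈ T, c a ^ 2) :=
          add_le_add (mul_le_mul_of_nonneg_left e1 hq) (mul_le_mul_of_nonneg_left e2 h0)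
      _ = ((1 - p) * Real.exp x + p * Real.exp y) * Real.exp (∑ a ∈ T, c a ^ 2) := by
          rw [Real.exp_add, Real.exp_add]; ring
      _ ≤ Real.exp ((1 - p) * x + p * y + (y - x) ^ 2) * Real.exp (∑ a ∈ T, c a ^ 2) := by
          gcongr
      _ ≤ _ := by
          rw [← Real.exp_add, Real.exp_le_exp]; linarith

open Classical in
/-- The probability that the random subset `V` of `T` has the property `P`. -/
noncomputable def bernProb (p : ℝ) (T : Finset W) (P : Finset W → Prop) : ℝ :=
  bernExp p T (fun V => if P V then 1 else 0)

lemma bernProb_mono (h0 : 0 ≤ p) (h1 : p ≤ 1) {P Q : Finset W → Prop} (h : ∀ V, P V → Q V) :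
    bernProb p T P ≤ bernProb p T Q :=
  bernExp_mono h0 h1 fun V => by
    by_cases hP : P V
    · simp [hP, h V hP]
    · simp only [hP, if_false]; split_ifs <;> norm_num

lemma bernProb_le_one (h0 : 0 ≤ p) (h1 : p ≤ 1) (P : Finset W → Prop) : bernProb p T P ≤ 1 := by
  rw [← bernExp_const p T 1]
  exact bernExp_mono h0 h1 fun V => by split_ifs <;> norm_num

lemma bernProb_not (P : Finset W → Prop) :
    bernProb p T (fun V => ¬ P V) = 1 - bernProb p T P := by
  unfold bernProb
  rw [eq_sub_iff_add_eq, ← bernExp_add]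
  refine Eq.trans ?_ (bernExp_const p T 1)
  congr 1
  ext V
  by_cases h : P V <;> simp [h]

lemma bernProb_insert {w : W} (hw : w ∉ T) (P : Finset W → Prop) :
    bernProb p (insert w T) P =
      (1 - p) * bernProb p T P + p * bernProb p T (fun V => P (insert w V)) :=
  bernExp_insert hw

lemma bernProb_or_le (h0 : 0 ≤ p) (h1 : p ≤ 1) (P Q : Finset W → Prop) :
    bernProb p T (fun V => P V ∨ Q V) ≤ bernProb p T P + bernProb p T Q := by
  unfold bernProb
  rw [← bernExp_add]
  refine bernExp_mono h0 h1 fun V => ?_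
  by_cases h : P V <;> by_cases h' : Q V <;> simp [h, h']

lemma bernProb_exists_le (h0 : 0 ≤ p) (h1 : p ≤ 1) {ι : Type*} (s : Finset ι)
    (P : ι → Finset W → Prop) :
    bernProb p T (fun V => ∃ i ∈ s, P i V) ≤ ∑ i ∈ s, bernProb p T (P i) := by
  classical
  unfold bernProb
  rw [← bernExp_sum]
  refine bernExp_mono h0 h1 fun V => ?_
  have hn : ∀ i ∈ s, (0 : ℝ) ≤ if P i V then 1 else 0 := fun i _ => by split_ifs <;> norm_num
  split_ifs with h
  · obtain ⟨i, hi, hP⟩ := h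
    refine le_trans ?_ (single_le_sum hn hi)
    simp [hP]
  · exact sum_nonneg hn

lemma bernProb_disjoint (N : Finset W) :
    bernProb p T (fun V => Disjoint N V) = (1 - p) ^ #(T ∩ N) := by
  induction T using Finset.induction_on with
  | empty => simp [bernProb, bernExp_empty]
  | insert w T hw ih =>
    rw [bernProb_insert hw, ih]
    by_cases h : w ∈ N
    · have : bernProb p T (fun V => Disjoint N (insert w V)) = 0 := by
        simp [bernProb, h, bernExp_const]
      rw [this, insert_inter_of_mem h, card_insert_of_notMem (by simp [hw])]
      ring
    · simp only [disjoint_insert_right, h, not_false_eq_true, true_and, ih,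
        insert_inter_of_notMem h]
      ring

/-- Lower tail for functions with bounded differences. -/
lemma bernProb_lt_le (h0 : 0 ≤ p) (h1 : p ≤ 1) (f : Finset W → ℝ) (R : Finset W) (hR : R ⊆ T)
    {d l θ : ℝ} (hl : 0 ≤ l) (hld : l * d ≤ 1)
    (hf : ∀ a ∈ R, ∀ V, |f (insert a V) - f V| ≤ d)
    (hf' : ∀ a ∉ R, ∀ V, f (insert a V) = f V) :
    bernProb p T (fun V => f V < θ) ≤
      Real.exp (l * θ - l * bernExp p T f + l ^ 2 * d ^ 2 * #R) := by
  -- Markov's inequality for exp(-l f); the parameter l stays free so that it can be optimised in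
  -- the application.
  have h2 : bernProb p T (fun V => f V < θ) ≤
      bernExp p T (fun V => Real.exp (l * θ) * Real.exp (-l * f V)) := by
    refine bernExp_mono h0 h1 fun V => ?_
    rw [← Real.exp_add]
    split_ifs with h
    · rw [Real.one_le_exp_iff]; nlinarith
    · positivity
  have h3 := bernExp_exp_le (T := T) h0 h1 (fun a => if a ∈ R then l * d else 0)
    (fun a => by split_ifs <;> linarith) (fun V => -l * f V) (fun a V => by
      split_ifs with h
      · rw [← mul_sub, abs_mul, abs_neg, abs_of_nonneg hl]
        exact mul_le_mul_of_nonneg_left (hf a h V) hl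
      · rw [hf' a h V]; simp)
  refine h2.trans ?_
  rw [bernExp_mul_left]
  refine (mul_le_mul_of_nonneg_left h3 (Real.exp_pos _).le).trans ?_
  rw [← Real.exp_add, Real.exp_le_exp, bernExp_mul_left]
  have : ∑ a ∈ T, (if a ∈ R then l * d else 0) ^ 2 = l ^ 2 * d ^ 2 * #R := by
    simp only [ite_pow, ne_eq, OfNat.ofNat_ne_zero, not_false_eq_true, zero_pow]
    rw [← sum_filter, filter_mem_eq_inter, inter_eq_right.2 hR, sum_const, nsmul_eq_mul]
    ring
  rw [this]
  linarith

end BernExp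

/-! ### Haxell's theorem on independent transversals. -/

section Transversal

variable {ι V : Type*} [DecidableEq ι]

/-- `T` picks pairwise unrelated elements from the classes with index in `J`. -/
def IsIndepTransversal (cls : V → ι) (R : V → V → Prop) (J : Finset ι) (T : ι → V) : Prop :=
  (∀ i ∈ J, cls (T i) = i) ∧ ∀ i ∈ J, ∀ j ∈ J, i ≠ j → ¬ R (T i) (T j)

lemma IsIndepTransversal.update {cls : V → ι} {R : V → V → Prop} (hR : ∀ u v, R u v → R v u)
    {J : Finset ι} {T : ι → V} (hT : IsIndepTransversal cls R J T) {y : V}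
    (hy : ∀ i ∈ J, ¬ R (T i) y) :
    IsIndepTransversal cls R (insert (cls y) J) (Function.update T (cls y) y) := by
  constructor
  · intro i hi
    by_cases h : i = cls y
    · subst h; simp
    · rw [Function.update_of_ne h]
      exact hT.1 i ((mem_insert.1 hi).resolve_left h)
  · intro i hi j hj hij
    by_cases h : i = cls y
    · subst h
      rw [Function.update_self, Function.update_of_ne hij.symm]
      exact fun h => hy j ((mem_insert.1 hj).resolve_left hij.symm) (hR _ _ h)
    · rw [Function.update_of_ne h]
      have hi' := (mem_insert.1 hi).resolve_left h
      by_cases h' : j = cls y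
      · subst h'
        rw [Function.update_self]
        exact hy i hi'
      · rw [Function.update_of_ne h']
        exact hT.2 i hi' j ((mem_insert.1 hj).resolve_left h') hij

/-- Modifying a partial independent transversal outside the classes of `S` so that some vertex in
the classes of `S` is related neither to the transversal nor to the dominating set `D`. -/
lemma exists_modified_transversal [DecidableEq V] {cls : V → ι} {R : V → V → Prop}
    (hR : ∀ u v, R u v → R v u)
    {J : Finset ι} {a : ι}
    (h : ∀ S ⊆ insert a J, S.Nonempty → ∀ D : Finset V, #D ≤ 2 * (#S - 1) →
      ∃ v, cls v ∈ S ∧ ∀ u ∈ D, ¬ R u v)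
    (S : Finset ι) (D : Finset V) (T₀ : ι → V) (hS : S ⊆ insert a J) (hne : S.Nonempty)
    (hD : #D ≤ 2 * (#S - 1)) (hT₀ : IsIndepTransversal cls R J T₀)
    (hSD : ∀ i ∈ J, i ∈ S → T₀ i ∈ D) :
    ∃ T y, IsIndepTransversal cls R J T ∧ cls y ∈ S ∧ (∀ i ∈ J, i ∈ S → T i = T₀ i) ∧
      (∀ i ∈ J, T i ≠ T₀ i → ∀ u ∈ D, ¬ R u (T i)) ∧ (∀ u ∈ D, ¬ R u y) ∧
      ∀ i ∈ J, ¬ R (T i) y := by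
  classical
  -- Two nested inductions: the outer one enlarges S; the inner one, on m below, lowers the number
  -- of transversal elements related to x. When that number is zero, x itself serves as y.
  induction hn : #(J \ S) using Nat.strong_induction_on generalizing S D T₀ with
  | _ n ih =>
  obtain ⟨x, hxS, hxD⟩ := h S hS hne D hD
  suffices H : ∀ m : ℕ, ∀ T, IsIndepTransversal cls R J T → (∀ i ∈ J, i ∈ S → T i = T₀ i) →
      (∀ i ∈ J, T i ≠ T₀ i → ∀ u ∈ D, ¬ R u (T i)) → #{i ∈ J | R (T i) x} = m →
      ∃ T y, IsIndepTransversal cls R J T ∧ cls y ∈ S ∧ (∀ i ∈ J, i ∈ S → T i = T₀ i) ∧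
      (∀ i ∈ J, T i ≠ T₀ i → ∀ u ∈ D, ¬ R u (T i)) ∧ (∀ u ∈ D, ¬ R u y) ∧
      ∀ i ∈ J, ¬ R (T i) y from
    H _ T₀ hT₀ (fun _ _ _ => rfl) (fun _ _ h => absurd rfl h) rfl
  intro m
  induction m using Nat.strong_induction_on with
  | _ m ihm =>
  intro T hT hTS hTD hm
  set N := {i ∈ J | R (T i) x} with hN
  by_cases hNe : N = ∅
  · refine ⟨T, x, hT, hxS, hTS, hTD, hxD, fun i hi hRi => ?_⟩
    have : i ∈ N := by simp [hN, hi, hRi]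
    simp [hNe] at this
  have hNJ : N ⊆ J := filter_subset _ _
  have hNS : Disjoint S N := by
    rw [Finset.disjoint_left]
    intro i hiS hiN
    have hiJ := hNJ hiN
    have := hxD _ (hSD i hiJ hiS)
    rw [← hTS i hiJ hiS] at this
    exact this (mem_filter.1 hiN).2
  have hN1 : 1 ≤ #N := card_pos.2 (nonempty_iff_ne_empty.2 hNe)
  have hS1 : 1 ≤ #S := card_pos.2 hne
  have hc1 : #(S ∪ N) = #S + #N := card_union_of_disjoint hNS
  have hc2 : #(insert x (D ∪ N.image T)) ≤ #D + #N + 1 :=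
    (card_insert_le _ _).trans (Nat.succ_le_succ ((card_union_le _ _).trans
      (Nat.add_le_add_left card_image_le _)))
  have hlt : #(J \ (S ∪ N)) < n := by
    rw [← hn]
    apply card_lt_card
    obtain ⟨i, hi⟩ := nonempty_iff_ne_empty.2 hNe
    refine (ssubset_iff_of_subset (sdiff_subset_sdiff subset_rfl subset_union_left)).2 ⟨i, ?_, ?_⟩
    · exact mem_sdiff.2 ⟨hNJ hi, Finset.disjoint_right.1 hNS hi⟩
    · simp [hi]
  -- Enlarge S by the set N of blocking classes, and D by x and the blockers. D grows by at most |N|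
  -- + 1 ≤ 2|N|, which is exactly what the bound 2(|S| - 1) permits.
  obtain ⟨T', y, hT', hyS, hTS', hTD', hyD, hyT⟩ := ih _ hlt (S ∪ N)
    (insert x (D ∪ N.image T)) T
    (union_subset hS (hNJ.trans (subset_insert _ _))) (hne.mono subset_union_left)
    (by omega) hT (by
      intro i hi hi'
      rcases mem_union.1 hi' with h1 | h1
      · rw [hTS i hi h1]
        exact mem_insert_of_mem (mem_union_left _ (hSD i hi h1))
      · exact mem_insert_of_mem (mem_union_right _ (mem_image_of_mem _ h1))) rfl
  have hDsub : ∀ u ∈ D, u ∈ insert x (D ∪ N.image T) := fun u hu =>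
    mem_insert_of_mem (mem_union_left _ hu)
  have hS' : ∀ i ∈ J, i ∈ S → T' i = T₀ i := fun i hi hiS => by
    rw [hTS' i hi (mem_union_left _ hiS), hTS i hi hiS]
  have hD' : ∀ i ∈ J, T' i ≠ T₀ i → ∀ u ∈ D, ¬ R u (T' i) := fun i hi hne u hu => by
    by_cases h1 : T' i = T i
    · rw [h1] at hne ⊢
      exact hTD i hi hne u hu
    · exact hTD' i hi h1 u (hDsub u hu)
  by_cases hyS' : cls y ∈ S
  · exact ⟨T', y, hT', hyS', hS', hD', fun u hu => hyD u (hDsub u hu), hyT⟩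
  have hyN : cls y ∈ N := (mem_union.1 hyS).resolve_left hyS'
  have hup := hT'.update hR hyT
  rw [insert_eq_of_mem (hNJ hyN)] at hup
  -- Here y lies in a blocking class and is unrelated to x, so swapping it in removes a blocker. No
  -- new blocker appears, since every changed element avoids x.
  refine ihm #{i ∈ J | R (Function.update T' (cls y) y i) x} ?_ _ hup ?_ ?_ rfl
  · rw [← hm]
    apply card_lt_card
    refine (ssubset_iff_of_subset fun i hi => ?_).2 ⟨cls y, hyN, ?_⟩
    · obtain ⟨hiJ, hRi⟩ := mem_filter.1 hi
      by_cases h1 : i = cls y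
      · subst h1; exact hyN
      · rw [Function.update_of_ne h1] at hRi
        by_cases h2 : T' i = T i
        · exact mem_filter.2 ⟨hiJ, h2 ▸ hRi⟩
        · exact absurd (hR _ _ hRi) (hTD' i hiJ h2 x (mem_insert_self _ _))
    · rw [mem_filter, Function.update_self]
      exact fun h1 => hyD x (mem_insert_self _ _) (hR _ _ h1.2)
  · intro i hi hiS
    rw [Function.update_of_ne (fun h1 : i = cls y => hyS' (h1 ▸ hiS)), hS' i hi hiS]
  · intro i hi hne u hu
    by_cases h1 : i = cls y
    · subst h1
      rw [Function.update_self]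
      exact hyD u (hDsub u hu)
    · rw [Function.update_of_ne h1] at hne ⊢
      exact hD' i hi hne u hu

/-- Haxell's theorem: if no `2 (|S| - 1)` vertices dominate the classes with index in `S`, for any
`S`, then there is an independent transversal. -/
theorem exists_indepTransversal [Fintype ι] [DecidableEq V] {cls : V → ι} {R : V → V → Prop}
    (hR : ∀ u v, R u v → R v u)
    (h : ∀ S : Finset ι, S.Nonempty → ∀ D : Finset V, #D ≤ 2 * (#S - 1) →
      ∃ v, cls v ∈ S ∧ ∀ u ∈ D, ¬ R u v) :
    ∃ T : ι → V, (∀ i, cls (T i) = i) ∧ ∀ i j, i ≠ j → ¬ R (T i) (T j) := by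
  suffices H : ∀ J : Finset ι, ∃ T, IsIndepTransversal cls R J T by
    obtain ⟨T, h1, h2⟩ := H univ
    exact ⟨T, fun i => h1 i (mem_univ _), fun i j => h2 i (mem_univ _) j (mem_univ _)⟩
  intro J
  induction J using Finset.induction_on with
  | empty =>
    have hv : ∀ i : ι, ∃ v : V, cls v = i := fun i => by
      obtain ⟨v, hv, -⟩ := h {i} (singleton_nonempty i) ∅ (by simp)
      exact ⟨v, by simpa using hv⟩
    choose T hT using hv
    exact ⟨T, by simp [IsIndepTransversal]⟩
  | insert a J ha ih =>
    obtain ⟨T₀, hT₀⟩ := ih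
    obtain ⟨T, y, hT, hy, -, -, -, hyT⟩ := exists_modified_transversal hR (a := a) (J := J)
      (fun S _ => h S) {a} ∅ T₀ (by simp) (singleton_nonempty a) (by simp) hT₀
      (fun i hi hia => by
        rw [mem_singleton] at hia
        exact absurd (hia ▸ hi) ha)
    have := hT.update hR hyT
    rw [mem_singleton.1 hy] at this
    exact ⟨_, this⟩

end Transversal

/-! ### One round of random expansion. -/

section Expansion

variable {W : Type*} [DecidableEq W] [Fintype W]

/-- A maximal set of edges of `E` in which all degrees are at most `d`. -/
lemma exists_maximal_bounded_degree (E : Finset (W × W)) (d : ℕ) :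
    ∃ H ⊆ E, (∀ u, #{e ∈ H | e.1 = u} ≤ d) ∧ (∀ v, #{e ∈ H | e.2 = v} ≤ d) ∧
      ∀ e ∈ E, e ∉ H → #{e' ∈ H | e'.1 = e.1} = d ∨ #{e' ∈ H | e'.2 = e.2} = d := by
  classical
  obtain ⟨H, hH, hmax⟩ := exists_max_image
    {H ∈ E.powerset | (∀ u : W, #{e ∈ H | e.1 = u} ≤ d) ∧ ∀ v : W, #{e ∈ H | e.2 = v} ≤ d} card
    ⟨∅, by simp⟩
  simp only [mem_filter, mem_powerset] at hH hmax
  refine ⟨H, hH.1, hH.2.1, hH.2.2, fun e he heH => ?_⟩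
  by_contra hcon
  rw [not_or] at hcon
  have h1 := lt_of_le_of_ne (hH.2.1 e.1) hcon.1
  have h2 := lt_of_le_of_ne (hH.2.2 e.2) hcon.2
  have := hmax (insert e H) ⟨insert_subset he hH.1, fun u => ?_, fun v => ?_⟩
  · rw [card_insert_of_notMem heH] at this
    omega
  · rw [filter_insert]
    split_ifs with h
    · subst h
      exact (card_insert_le _ _).trans h1
    · exact hH.2.1 u
  · rw [filter_insert]
    split_ifs with h
    · subst h
      exact (card_insert_le _ _).trans h2
    · exact hH.2.2 v

lemma card_mul_le_of_fiber {α β : Type*} [DecidableEq β] (H : Finset α) (g : α → β)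
    (C : Finset β) (d : ℕ) (hC : ∀ u ∈ C, d ≤ #{e ∈ H | g e = u}) : #C * d ≤ #H := by
  have h1 : ∑ u ∈ C, #{e ∈ H | g e = u} ≤ #H := by
    classical
    rw [← card_biUnion]
    · exact card_le_card fun e he => by
        obtain ⟨u, -, hu⟩ := mem_biUnion.1 he
        exact (mem_filter.1 hu).1
    · intro u _ v _ huv
      rw [Function.onFun, Finset.disjoint_left]
      intro e he he'
      exact huv ((mem_filter.1 he).2.symm.trans (mem_filter.1 he').2)
  refine le_trans ?_ h1
  rw [← smul_eq_mul, ← sum_const]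
  exact sum_le_sum hC

/-- In an expander a set `R` has many edges to the outside of `R ∪ Z` with all degrees at most
`d`. -/
lemma exists_bounded_degree_edges {G : SimpleGraph W} {ε c s : ℝ} (hG : IsExpander G ε c s)
    {η : ℝ} (hη0 : 0 < η) (hη1 : 20 * η ≤ 1)
    (hη : 20 * η = ε / (Real.logb 2 (Fintype.card W : ℝ)) ^ c) {d : ℕ} (hd : 1 ≤ d)
    (hds : (d : ℝ) ≤ s) (R Z : Finset W) (hR : R.Nonempty)
    (hRn : (#R : ℝ) ≤ 2 / 3 * (Fintype.card W : ℝ)) (hZ : (#Z : ℝ) ≤ η * #R) :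
    ∃ H : Finset (W × W), (∀ e ∈ H, e.1 ∈ R ∧ e.2 ∉ R ∧ e.2 ∉ Z ∧ G.Adj e.1 e.2) ∧
      (∀ u, #{e ∈ H | e.1 = u} ≤ d) ∧ (∀ v, #{e ∈ H | e.2 = v} ≤ d) ∧
      4 * d * η * #R ≤ (#H : ℝ) := by
  classical
  obtain ⟨H, hHE, hH1, hH2, hmax⟩ := exists_maximal_bounded_degree
    {e : W × W | e.1 ∈ R ∧ e.2 ∉ R ∧ e.2 ∉ Z ∧ G.Adj e.1 e.2} d
  have hHE' : ∀ e ∈ H, e.1 ∈ R ∧ e.2 ∉ R ∧ e.2 ∉ Z ∧ G.Adj e.1 e.2 := fun e he => by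
    simpa using hHE he
  refine ⟨H, hHE', hH1, hH2, ?_⟩
  by_contra! hlt
  have hR0 : (0 : ℝ) < #R := by exact_mod_cast card_pos.2 hR
  have hd0 : (0 : ℝ) < d := by exact_mod_cast hd
  set C : Finset W := {u | #{e ∈ H | e.1 = u} = d} with hC
  set X : Finset W := {u | #{e ∈ H | e.2 = u} = d} with hX
  have hCc : (#C : ℝ) * d ≤ #H := by
    exact_mod_cast card_mul_le_of_fiber H Prod.fst C d fun u hu => (by simpa [hC] using hu : _ = d).ge
  have hXc : (#X : ℝ) * d ≤ #H := by
    exact_mod_cast card_mul_le_of_fiber H Prod.snd X d fun u hu => (by simpa [hX] using hu : _ = d).ge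
  have hC' : (#C : ℝ) < 4 * η * #R := by
    refine lt_of_mul_lt_mul_right ?_ hd0.le
    linarith
  have hX' : (#X : ℝ) < 4 * η * #R := by
    refine lt_of_mul_lt_mul_right ?_ hd0.le
    linarith
  have hU : (#R : ℝ) - #C ≤ #(R \ C) := by
    have := le_card_sdiff C R
    rw [tsub_le_iff_right] at this
    rw [sub_le_iff_le_add]
    exact_mod_cast this
  have hηR : η * #R ≤ 1 / 20 * #R := mul_le_mul_of_nonneg_right (by linarith) hR0.le
  have hU' : 4 / 5 * (#R : ℝ) ≤ #(R \ C) := by linarith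
  have hU0 : (0 : ℝ) < #(R \ C) := by linarith
  -- C and X are the saturated vertices inside and outside R. By maximality of H, the neighbours of
  -- R \ C in G - H lie in C ∪ X ∪ Z, which has fewer than 9η|R| elements. Expansion gives at least
  -- 20η · (4/5)|R| = 16η|R|.
  have hexp := hG (↑(R \ C)) (↑(H.image fun e => s(e.1, e.2))) (by
      intro f hf
      obtain ⟨e, he, rfl⟩ := mem_image.1 (mem_coe.1 hf)
      exact (hHE' e he).2.2.2)
    (by
      rw [Set.ncard_coe_finset]
      exact_mod_cast hU0)
    (by
      rw [Set.ncard_coe_finset]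
      exact le_trans (by exact_mod_cast card_le_card sdiff_subset) hRn)
    (by
      rw [Set.ncard_coe_finset, Set.ncard_coe_finset]
      have h1 : (#(H.image fun e => s(e.1, e.2)) : ℝ) ≤ #H := by exact_mod_cast card_image_le
      have h2 : 4 * d * η * #R ≤ d * (4 / 5 * (#R : ℝ)) := by nlinarith
      have hs : 0 ≤ s := hd0.le.trans hds
      have h3 : d * (4 / 5 * (#R : ℝ)) ≤ s * #(R \ C) := by gcongr
      linarith)
  rw [← hη, Set.ncard_coe_finset] at hexp
  have hsub : outerNeighbors (G.deleteEdges ↑(H.image fun e => s(e.1, e.2))) ↑(R \ C) ⊆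
      ↑(C ∪ X ∪ Z) := by
    rintro v ⟨hv, u, hu, huv⟩
    rw [mem_coe] at hv hu ⊢
    rw [SimpleGraph.deleteEdges_adj] at huv
    obtain ⟨huR, huC⟩ := mem_sdiff.1 hu
    by_contra hcon
    simp only [mem_union, not_or] at hcon
    have hvR : v ∉ R := fun h => hv (mem_sdiff.2 ⟨h, hcon.1.1⟩)
    have heH : (u, v) ∉ H := fun h => huv.2 (mem_coe.2 (mem_image.2 ⟨_, h, rfl⟩))
    rcases hmax (u, v) (by simp [huR, hvR, hcon.2, huv.1]) heH with h | h
    · exact huC (by simpa [hC] using h)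
    · exact hcon.1.2 (by simpa [hX] using h)
  have hcard : ((outerNeighbors (G.deleteEdges ↑(H.image fun e => s(e.1, e.2)))
      ↑(R \ C)).ncard : ℝ) ≤ #C + #X + #Z := by
    have h1 := Set.ncard_le_ncard hsub
    rw [Set.ncard_coe_finset] at h1
    exact_mod_cast h1.trans ((card_union_le _ _).trans
      (Nat.add_le_add_right (card_union_le _ _) _))
  have : 20 * η * (4 / 5 * #R) ≤ 20 * η * (#(R \ C) : ℝ) := by gcongr
  nlinarith

/-- `1 - (1 - p) ^ k ≥ p k / 2` as long as `p k ≤ 1`. -/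
lemma half_mul_le_one_sub_pow {p : ℝ} (h0 : 0 ≤ p) (h1 : p ≤ 1) {k : ℕ} (hk : p * k ≤ 1) :
    p * k / 2 ≤ 1 - (1 - p) ^ k := by
  have h2 : (1 - p) ^ k ≤ Real.exp (-(p * k)) := by
    calc (1 - p) ^ k ≤ (Real.exp (-p)) ^ k :=
          pow_le_pow_left₀ (by linarith) (by linarith [Real.add_one_le_exp (-p)]) k
      _ = _ := by rw [← Real.exp_nat_mul]; ring_nf
  have hy : 0 ≤ p * k := by positivity
  have h3 : Real.exp (-(p * k)) ≤ 1 - p * k / 2 := by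
    rw [Real.exp_neg, inv_le_comm₀ (Real.exp_pos _) (by linarith)]
    refine le_trans ?_ (Real.add_one_le_exp (p * k))
    rw [inv_le_iff_one_le_mul₀ (by linarith)]
    nlinarith
  linarith

/-- The neighbours outside `R ∪ Z` of the vertices in `R ∩ V`. -/
noncomputable def freshNeighbors (G : SimpleGraph W) (R Z V : Finset W) : Finset W := by
  classical exact {v | v ∉ R ∧ v ∉ Z ∧ ∃ u ∈ R, u ∈ V ∧ G.Adj u v}

/-- A random subset of `R` has many neighbours outside `R ∪ Z`. -/
lemma bernProb_freshNeighbors_lt {G : SimpleGraph W} {ε c s : ℝ} (hG : IsExpander G ε c s)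
    {η : ℝ} (hη0 : 0 < η) (hη1 : 20 * η ≤ 1)
    (hη : 20 * η = ε / (Real.logb 2 (Fintype.card W : ℝ)) ^ c) {p : ℝ} (hp0 : 0 < p)
    (hp1 : p ≤ 1) (hps : 1 / p ≤ s) (R Z : Finset W) (hR : R.Nonempty)
    (hRn : (#R : ℝ) ≤ 2 / 3 * (Fintype.card W : ℝ)) (hZ : (#Z : ℝ) ≤ η * #R) :
    bernProb p univ (fun V => (#(freshNeighbors G R Z V) : ℝ) < η / 2 * #R) ≤
      Real.exp (-(η ^ 2 * p ^ 2 / 16 * #R)) := by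
  classical
  -- With this degree bound, 1/2 ≤ pd ≤ 1: a vertex with k edges of H is hit with probability at
  -- least pk/2, and the expected number of hit vertices is at least p|H|/2 ≥ η|R|.
  set d : ℕ := ⌊1 / p⌋₊ with hd
  have hp1' : 1 ≤ 1 / p := by rw [le_div_iff₀ hp0]; linarith
  have hd1 : 1 ≤ d := Nat.le_floor (by exact_mod_cast hp1')
  have hd1' : (1 : ℝ) ≤ d := by exact_mod_cast hd1
  have hdp : (d : ℝ) ≤ 1 / p := Nat.floor_le (by positivity)
  have hdp' : 1 / p ≤ 2 * d := by
    have := (Nat.lt_floor_add_one (1 / p)).le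
    rw [← hd] at this
    linarith
  have hpd : p * d ≤ 1 := by rw [le_div_iff₀ hp0] at hdp; linarith
  have hpd' : 1 ≤ 2 * (p * d) := by rw [div_le_iff₀ hp0] at hdp'; linarith
  obtain ⟨H, hHE, hH1, hH2, hHc⟩ := exists_bounded_degree_edges hG hη0 hη1 hη hd1
    (hdp.trans hps) R Z hR hRn hZ
  set hit : Finset W → Finset W := fun V => {v | ∃ e ∈ H, e.2 = v ∧ e.1 ∈ V} with hhit
  have hR0 : (0 : ℝ) < #R := by exact_mod_cast card_pos.2 hR
  have hsub : ∀ V, hit V ⊆ freshNeighbors G R Z V := by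
    intro V v hv
    obtain ⟨e, he, rfl, heV⟩ : ∃ e ∈ H, e.2 = v ∧ e.1 ∈ V := by simpa [hhit] using hv
    obtain ⟨h1, h2, h3, h4⟩ := hHE e he
    simp only [freshNeighbors, mem_filter, mem_univ, true_and]
    exact ⟨h2, h3, e.1, h1, heV, h4⟩
  have hmean : η * #R ≤ bernExp p univ (fun V => (#(hit V) : ℝ)) := by
    have e1 : (fun V => (#(hit V) : ℝ)) =
        fun V => ∑ v : W, if ¬ Disjoint ({e ∈ H | e.2 = v}.image Prod.fst) V then (1 : ℝ) else 0 := by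
      ext V
      rw [← sum_filter, sum_const, nsmul_eq_mul, mul_one]
      congr 2
      ext v
      simp only [hhit, mem_filter, mem_univ, true_and, Finset.not_disjoint_iff, mem_image]
      constructor
      · rintro ⟨e, he, hv, heV⟩
        exact ⟨e.1, ⟨e, ⟨he, hv⟩, rfl⟩, heV⟩
      · rintro ⟨u, ⟨e, ⟨he, hv⟩, rfl⟩, heV⟩
        exact ⟨e, he, hv, heV⟩
    have e2 : ∀ v, p * (#{e ∈ H | e.2 = v} : ℝ) / 2 ≤ bernProb p univ
        (fun V => ¬ Disjoint ({e ∈ H | e.2 = v}.image Prod.fst) V) := by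
      intro v
      rw [bernProb_not, bernProb_disjoint, univ_inter, card_image_of_injOn]
      · refine half_mul_le_one_sub_pow hp0.le hp1 (le_trans ?_ hpd)
        gcongr
        exact hH2 v
      · intro a ha b hb hab
        rw [mem_coe, mem_filter] at ha hb
        exact Prod.ext hab (ha.2.trans hb.2.symm)
    have e3 : (#H : ℝ) = ∑ v : W, (#{e ∈ H | e.2 = v} : ℝ) := by
      exact_mod_cast card_eq_sum_card_fiberwise (f := Prod.snd) (fun e _ => mem_coe.2 (mem_univ _))
    rw [e1, bernExp_sum]
    calc η * #R ≤ p * (4 * d * η * #R) / 2 := by nlinarith [mul_pos hη0 hR0]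
      _ ≤ p * #H / 2 := by gcongr
      _ = ∑ v : W, p * (#{e ∈ H | e.2 = v} : ℝ) / 2 := by
          rw [e3, mul_sum, sum_div]
      _ ≤ _ := by
          refine sum_le_sum fun v _ => (e2 v).trans (le_of_eq ?_)
          unfold bernProb
          congr!
  have hmono : ∀ a V, hit V ⊆ hit (insert a V) := by
    intro a V v
    simp only [hhit, mem_filter, mem_univ, true_and]
    rintro ⟨e, he, hv, heV⟩
    exact ⟨e, he, hv, mem_insert_of_mem heV⟩
  have hdiff : ∀ a V, hit (insert a V) ⊆ hit V ∪ {e ∈ H | e.1 = a}.image Prod.snd := by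
    intro a V v
    simp only [hhit, mem_filter, mem_univ, true_and, mem_union, mem_image, mem_insert]
    rintro ⟨e, he, hv, heV | heV⟩
    · exact Or.inr ⟨e, ⟨he, heV⟩, hv⟩
    · exact Or.inl ⟨e, he, hv, heV⟩
  -- This l minimises the exponent -lη|R|/2 + l²d²|R|.
  have htail := bernProb_lt_le (T := univ) hp0.le hp1 (fun V => (#(hit V) : ℝ)) R
    (subset_univ R) (d := d) (l := η / (4 * d ^ 2)) (θ := η / 2 * #R) (by positivity)
    (by
      have : η / (4 * (d : ℝ) ^ 2) * d = η / (4 * d) := by field_simp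
      rw [this, div_le_one (by positivity)]
      linarith)
    (fun a _ V => by
      have h1 : (#(hit V) : ℝ) ≤ #(hit (insert a V)) := by exact_mod_cast card_le_card (hmono a V)
      rw [abs_of_nonneg (by linarith), sub_le_iff_le_add]
      have := (card_le_card (hdiff a V)).trans ((card_union_le _ _).trans
        (Nat.add_le_add_left (card_image_le.trans (hH1 a)) _))
      rw [add_comm]
      exact_mod_cast this)
    (fun a ha V => by
      have : ({e ∈ H | e.1 = a} : Finset (W × W)) = ∅ := by
        rw [filter_eq_empty_iff]
        exact fun e he h => ha (h ▸ (hHE e he).1)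
      have h2 := hdiff a V
      rw [this, image_empty, union_empty] at h2
      rw [subset_antisymm h2 (hmono a V)])
  refine (bernProb_mono hp0.le hp1 (fun V hV => ?_)).trans (htail.trans ?_)
  · exact lt_of_le_of_lt (by exact_mod_cast card_le_card (hsub V)) hV
  · rw [Real.exp_le_exp]
    have h1 : η / (4 * (d : ℝ) ^ 2) * (η * #R) ≤
        η / (4 * (d : ℝ) ^ 2) * bernExp p univ (fun V => (#(hit V) : ℝ)) := by gcongr
    have h2 : (η / (4 * (d : ℝ) ^ 2)) * (η / 2 * #R) - η / (4 * (d : ℝ) ^ 2) * (η * #R) +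
        (η / (4 * (d : ℝ) ^ 2)) ^ 2 * d ^ 2 * #R = -(η ^ 2 / (16 * d ^ 2) * #R) := by
      field_simp
      ring
    have h3 : η ^ 2 * p ^ 2 / 16 ≤ η ^ 2 / (16 * (d : ℝ) ^ 2) := by
      rw [le_div_iff₀ (by positivity)]
      have : (p * d) ^ 2 ≤ 1 := pow_le_one₀ (by positivity) hpd
      nlinarith [sq_nonneg η]
    have h4 : η ^ 2 * p ^ 2 / 16 * #R ≤ η ^ 2 / (16 * (d : ℝ) ^ 2) * #R := by gcongr
    linarith

end Expansion

/-! ### Reached sets and good chains. -/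

section Reach

variable {W : Type*} [DecidableEq W] [Fintype W] {G : SimpleGraph W}

open Classical in
/-- The vertices outside `Z` that are the endpoint of a walk of length between `1` and `k + 1` which
starts in `X` and has all its internal vertices in `A \ Z`. -/
noncomputable def reach (G : SimpleGraph W) (A Z X : Finset W) : ℕ → Finset W
  | 0 => {v | v ∉ Z ∧ ∃ u ∈ X, G.Adj u v}
  | k + 1 => reach G A Z X k ∪
    ({v | v ∉ Z ∧ ∃ u ∈ reach G A Z X k, u ∈ A ∧ G.Adj u v} : Finset W)

lemma mem_reach_zero {A Z X : Finset W} {v : W} :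
    v ∈ reach G A Z X 0 ↔ v ∉ Z ∧ ∃ u ∈ X, G.Adj u v := by
  simp [reach]

lemma mem_reach_succ {A Z X : Finset W} {k : ℕ} {v : W} :
    v ∈ reach G A Z X (k + 1) ↔ v ∈ reach G A Z X k ∨
      v ∉ Z ∧ ∃ u ∈ reach G A Z X k, u ∈ A ∧ G.Adj u v := by
  simp [reach]

lemma reach_subset_succ (A Z X : Finset W) (k : ℕ) : reach G A Z X k ⊆ reach G A Z X (k + 1) :=
  fun _ hv => mem_reach_succ.2 (Or.inl hv)

lemma notMem_of_mem_reach {A Z X : Finset W} {k : ℕ} {v : W} (hv : v ∈ reach G A Z X k) :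
    v ∉ Z := by
  induction k with
  | zero => exact (mem_reach_zero.1 hv).1
  | succ k ih => exact (mem_reach_succ.1 hv).elim ih And.left

lemma reach_mono {A B : Finset W} (h : A ⊆ B) (Z X : Finset W) (k : ℕ) :
    reach G A Z X k ⊆ reach G B Z X k := by
  induction k with
  | zero => exact fun v hv => mem_reach_zero.2 (mem_reach_zero.1 hv)
  | succ k ih =>
    intro v hv
    rcases mem_reach_succ.1 hv with hv | ⟨hv, u, hu, huA, huv⟩
    · exact mem_reach_succ.2 (Or.inl (ih hv))
    · exact mem_reach_succ.2 (Or.inr ⟨hv, u, ih hu, h huA, huv⟩)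

/-- A walk has only one starting vertex. This additivity is what makes bisecting the set of
terminals possible. -/
lemma reach_union (A Z X Y : Finset W) (k : ℕ) :
    reach G A Z (X ∪ Y) k = reach G A Z X k ∪ reach G A Z Y k := by
  induction k with
  | zero =>
    ext v
    simp only [mem_union, mem_reach_zero]
    grind
  | succ k ih =>
    ext v
    simp only [mem_union, mem_reach_succ, ih]
    grind

lemma exists_walk_of_mem_reach {A Z X : Finset W} {k : ℕ} {v : W} (hv : v ∈ reach G A Z X k) :
    ∃ x ∈ X, ∃ p : G.Walk x v, p.length ≤ k + 1 ∧
      ∀ w ∈ p.support, w = x ∨ w = v ∨ (w ∈ A ∧ w ∉ Z) := by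
  induction k generalizing v with
  | zero =>
    obtain ⟨-, u, hu, huv⟩ := mem_reach_zero.1 hv
    refine ⟨u, hu, huv.toWalk, by simp, fun w hw => ?_⟩
    simp at hw
    tauto
  | succ k ih =>
    rcases mem_reach_succ.1 hv with hv | ⟨-, u, hu, huA, huv⟩
    · obtain ⟨x, hx, p, hp, hs⟩ := ih hv
      exact ⟨x, hx, p, by omega, hs⟩
    · obtain ⟨x, hx, p, hp, hs⟩ := ih hu
      refine ⟨x, hx, p.concat huv, by simpa using hp, fun w hw => ?_⟩
      rw [SimpleGraph.Walk.support_concat, List.mem_append,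
        List.mem_singleton] at hw
      rcases hw with hw | hw
      · rcases hs w hw with h | h | h
        · exact Or.inl h
        · exact Or.inr (Or.inr (h ▸ ⟨huA, notMem_of_mem_reach hu⟩))
        · exact Or.inr (Or.inr h)
      · exact Or.inr (Or.inl hw)

lemma exists_path_of_mem_reach {A Z : Finset W} {k : ℕ} {x y u : W}
    (hx : u ∈ reach G A Z {x} k) (hy : u ∈ reach G A Z {y} k) (hu : u ∈ A) :
    ∃ p : G.Walk x y, p.IsPath ∧ p.length ≤ 2 * (k + 1) ∧
      ∀ w ∈ p.support, w = x ∨ w = y ∨ (w ∈ A ∧ w ∉ Z) := by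
  have huZ := notMem_of_mem_reach hx
  obtain ⟨x', hx', p, hp, hps⟩ := exists_walk_of_mem_reach hx
  obtain ⟨y', hy', p', hp', hps'⟩ := exists_walk_of_mem_reach hy
  obtain rfl := mem_singleton.1 hx'
  obtain rfl := mem_singleton.1 hy'
  refine ⟨(p.append p'.reverse).bypass, SimpleGraph.Walk.bypass_isPath _, ?_, fun w hw => ?_⟩
  · refine (SimpleGraph.Walk.length_bypass_le_length _).trans ?_
    rw [SimpleGraph.Walk.length_append, SimpleGraph.Walk.length_reverse]
    omega
  · have hw' := SimpleGraph.Walk.support_bypass_subset_support _ hw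
    rw [SimpleGraph.Walk.mem_support_append_iff, SimpleGraph.Walk.support_reverse,
      List.mem_reverse] at hw'
    rcases hw' with hw | hw
    · rcases hps w hw with h | h | h
      · exact Or.inl h
      · exact Or.inr (Or.inr (h ▸ ⟨hu, huZ⟩))
      · exact Or.inr (Or.inr h)
    · rcases hps' w hw with h | h | h
      · exact Or.inr (Or.inl h)
      · exact Or.inr (Or.inr (h ▸ ⟨hu, huZ⟩))
      · exact Or.inr (Or.inr h)

/-- All large reached sets grow when the allowed internal vertices are extended from `A` to `B`, and
`B` meets all large intersections of two reached sets. -/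
structure GoodStep (G : SimpleGraph W) (D η : ℝ) (k : ℕ) (A B : Finset W) : Prop where
  grow : ∀ X Z : Finset W, D * (#X + #Z + 1) ≤ #(reach G A Z X k) →
    (#(reach G A Z X k) : ℝ) ≤ 2 / 3 * (Fintype.card W : ℝ) →
    (1 + η / 2) * #(reach G A Z X k) ≤ #(reach G B Z X (k + 1))
  hit : ∀ X Y Z : Finset W, D * (#X + #Y + #Z + 1) ≤ #(reach G A Z X k ∩ reach G A Z Y k) →
    ∃ u ∈ reach G A Z X k ∩ reach G A Z Y k, u ∈ B

/-- `V` is the last set of an increasing chain in which the first `k` steps are good. -/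
def GoodChain (G : SimpleGraph W) (D η : ℝ) : ℕ → Finset W → Prop
  | 0, _ => True
  | k + 1, V => ∃ A ⊆ V, GoodChain G D η k A ∧ GoodStep G D η k A V

lemma GoodChain.exists_seq {D η : ℝ} {M : ℕ} {V : Finset W} (h : GoodChain G D η M V) :
    ∃ f : ℕ → Finset W, f M = V ∧
      ∀ k < M, f k ⊆ f (k + 1) ∧ GoodStep G D η k (f k) (f (k + 1)) := by
  induction M generalizing V with
  | zero => exact ⟨fun _ => V, rfl, by simp⟩
  | succ M ih =>
    obtain ⟨A, hA, hc, hs⟩ := h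
    obtain ⟨f, hf, hfs⟩ := ih hc
    refine ⟨fun k => if k ≤ M then f k else V, by simp, fun k hk => ?_⟩
    rcases (Nat.lt_succ_iff.1 hk).lt_or_eq with hk | rfl
    · simpa [hk.le, Nat.succ_le_of_lt hk] using hfs k hk
    · simpa [hf] using ⟨hA, hs⟩

/-! ### Deterministic growth along a good chain. -/

section Chain

variable {D η : ℝ} {M : ℕ} {f : ℕ → Finset W}

lemma reach_seq_mono (hf : ∀ k < M, f k ⊆ f (k + 1) ∧ GoodStep G D η k (f k) (f (k + 1)))
    (X Z : Finset W) {i j : ℕ} (hij : i ≤ j) (hj : j ≤ M) :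
    reach G (f i) Z X i ⊆ reach G (f j) Z X j := by
  induction j, hij using Nat.le_induction with
  | base => exact subset_rfl
  | succ j hij ih =>
    exact (ih (by omega)).trans ((reach_mono (hf j (by omega)).1 _ _ _).trans
      (reach_subset_succ _ _ _ _))

/-- Reached sets only increase along the chain, so the size threshold for growth persists and the
growth step can be iterated until 2n/3 is exceeded. -/
lemma reach_seq_grow (hf : ∀ k < M, f k ⊆ f (k + 1) ∧ GoodStep G D η k (f k) (f (k + 1)))
    (hη : 0 ≤ η) (X Z : Finset W) {i : ℕ} (hX : D * (#X + #Z + 1) ≤ #(reach G (f i) Z X i))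
    (j : ℕ) (hj : i + j ≤ M) :
    2 / 3 * (Fintype.card W : ℝ) < #(reach G (f (i + j)) Z X (i + j)) ∨
      (1 + η / 2) ^ j * #(reach G (f i) Z X i) ≤ #(reach G (f (i + j)) Z X (i + j)) := by
  induction j with
  | zero => right; simp
  | succ j ih =>
    have hmono : ∀ {a b : ℕ}, a ≤ b → b ≤ M →
        (#(reach G (f a) Z X a) : ℝ) ≤ #(reach G (f b) Z X b) := fun h h' => by
      exact_mod_cast card_le_card (reach_seq_mono hf X Z h h')
    by_cases hlt : 2 / 3 * (Fintype.card W : ℝ) < #(reach G (f (i + j)) Z X (i + j))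
    · exact Or.inl (hlt.trans_le (hmono (by omega) hj))
    · right
      have h1 := (ih (by omega)).resolve_left hlt
      have h2 := (hf (i + j) (by omega)).2.grow X Z
        (hX.trans (hmono (by omega) (by omega))) (not_lt.1 hlt)
      rw [pow_succ, mul_comm _ (1 + η / 2), mul_assoc]
      exact (mul_le_mul_of_nonneg_left h1 (by positivity)).trans h2

lemma reach_seq_large (hf : ∀ k < M, f k ⊆ f (k + 1) ∧ GoodStep G D η k (f k) (f (k + 1)))
    (hη : 0 ≤ η) (hD : 1 ≤ D) {l : ℕ} (hl : (Fintype.card W : ℝ) ≤ (1 + η / 2) ^ l)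
    (X Z : Finset W) {i : ℕ} (hX : D * (#X + #Z + 1) ≤ #(reach G (f i) Z X i))
    (hi : i + l ≤ M) :
    2 / 3 * (Fintype.card W : ℝ) < #(reach G (f (i + l)) Z X (i + l)) := by
  rcases reach_seq_grow hf hη X Z hX l hi with h | h
  · exact h
  · have h1 : (1 : ℝ) ≤ #(reach G (f i) Z X i) := by
      refine le_trans ?_ hX
      have : (0 : ℝ) ≤ #X + #Z := by positivity
      nlinarith
    have h2 : (1 : ℝ) ≤ Fintype.card W := h1.trans (by exact_mod_cast card_le_univ _)
    have h3 : (1 + η / 2) ^ l * 1 ≤ (1 + η / 2) ^ l * #(reach G (f i) Z X i) := by gcongr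
    linarith

/-- If X reaches more than 2n/3 vertices, one of its halves reaches at least n/3. This exceeds the
growth threshold, so l further rounds bring that half above 2n/3 again; after t halvings one element
remains. -/
lemma exists_singleton_reach (hf : ∀ k < M, f k ⊆ f (k + 1) ∧ GoodStep G D η k (f k) (f (k + 1)))
    (hη : 0 ≤ η) (hD : 1 ≤ D) {l : ℕ} (hl : (Fintype.card W : ℝ) ≤ (1 + η / 2) ^ l)
    (Z : Finset W) (t : ℕ) (X : Finset W) (hXne : X.Nonempty) (hXt : #X ≤ 2 ^ t) (i : ℕ)
    (hsmall : D * (#X + #Z + 1) ≤ 1 / 3 * (Fintype.card W : ℝ))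
    (hX : 2 / 3 * (Fintype.card W : ℝ) < #(reach G (f i) Z X i)) (hi : i + t * l ≤ M) :
    ∃ x ∈ X, 2 / 3 * (Fintype.card W : ℝ) < #(reach G (f (i + t * l)) Z {x} (i + t * l)) := by
  induction t generalizing X i with
  | zero =>
    obtain ⟨x, hx⟩ := hXne
    have : X = {x} := by
      refine eq_singleton_iff_unique_mem.2 ⟨hx, fun y hy => ?_⟩
      exact card_le_one.1 hXt y hy x hx
    subst this
    exact ⟨x, hx, by simpa using hX⟩
  | succ t ih =>
    have hit : i + (t + 1) * l = i + l + t * l := by ring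
    rw [hit] at hi ⊢
    have key : ∀ Y ⊆ X, Y.Nonempty → #Y ≤ 2 ^ t →
        1 / 3 * (Fintype.card W : ℝ) ≤ #(reach G (f i) Z Y i) →
        ∃ x ∈ X, 2 / 3 * (Fintype.card W : ℝ) <
          #(reach G (f (i + l + t * l)) Z {x} (i + l + t * l)) := by
      intro Y hYX hY hYt hYr
      have hYc : D * (#Y + #Z + 1) ≤ D * (#X + #Z + 1) := by
        have : (#Y : ℝ) ≤ #X := by exact_mod_cast card_le_card hYX
        gcongr
      have h1 := reach_seq_large hf hη hD hl Y Z (hYc.trans (hsmall.trans hYr))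
        (i := i) (by omega)
      obtain ⟨x, hx, hxr⟩ := ih Y hY hYt (i + l) (hYc.trans hsmall) h1 hi
      exact ⟨x, hYX hx, hxr⟩
    by_cases hsz : #X ≤ 2 ^ t
    · refine key X subset_rfl hXne hsz ?_
      have : (0 : ℝ) ≤ Fintype.card W := by positivity
      linarith
    · obtain ⟨Y, hYX, hYc⟩ := exists_subset_card_eq (not_le.1 hsz).le
      have hYc' : #(X \ Y) ≤ 2 ^ t := by
        rw [card_sdiff_of_subset hYX, hYc]
        rw [pow_succ] at hXt
        omega
      have hun := reach_union (G := G) (f i) Z Y (X \ Y) i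
      rw [union_sdiff_of_subset hYX] at hun
      have hcard : (#(reach G (f i) Z X i) : ℝ) ≤
          #(reach G (f i) Z Y i) + #(reach G (f i) Z (X \ Y) i) := by
        rw [hun]; exact_mod_cast card_union_le _ _
      by_cases h : 1 / 3 * (Fintype.card W : ℝ) ≤ #(reach G (f i) Z Y i)
      · exact key Y hYX (card_pos.1 (by rw [hYc]; positivity)) hYc.le h
      · refine key (X \ Y) sdiff_subset (card_pos.1 ?_) hYc' (by linarith)
        rw [card_sdiff_of_subset hYX]
        omega

end Chain

end Reach

/-! ### Connecting one pair, then all pairs disjointly. -/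

section Connect

variable {W : Type*} [DecidableEq W] [Fintype W] {G : SimpleGraph W}

/-- If `V` is the end of a good chain, then for any small set `Z` some pair `x i, y i` is connected
by a short path through `V \ Z`. -/
lemma GoodChain.exists_path {D η K : ℝ} {l t M : ℕ} {V : Finset W} (hV : GoodChain G D η M V)
    (hM : M = (t + 1) * l + 1) (hη : 0 ≤ η) (hD : 1 ≤ D)
    (hl : (Fintype.card W : ℝ) ≤ (1 + η / 2) ^ l) (ht : Fintype.card W ≤ 2 ^ t)
    (hK : 80 * D * M ≤ K) {ι : Type*} {x y : ι → W}
    (hx : Function.Injective x) (hy : Function.Injective y)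
    (hxN : ∀ X : Finset ι, K * #X ≤ ((outerNeighbors G ↑(X.image x)).ncard : ℝ))
    (hyN : ∀ X : Finset ι, K * #X ≤ ((outerNeighbors G ↑(X.image y)).ncard : ℝ))
    (S : Finset ι) (hS : S.Nonempty) (Z : Finset W) (hZ : #Z ≤ 6 * M * #S) :
    ∃ i ∈ S, ∃ p : G.Walk (x i) (y i), p.IsPath ∧ p.length ≤ 2 * M ∧
      ∀ w ∈ p.support, w = x i ∨ w = y i ∨ (w ∈ V ∧ w ∉ Z) := by
  classical
  obtain ⟨f, hfV, hf⟩ := hV.exists_seq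
  have hS1 : (1 : ℝ) ≤ #S := by exact_mod_cast card_pos.2 hS
  have hM1 : (1 : ℝ) ≤ M := by rw [hM]; push_cast; nlinarith [show (0 : ℝ) ≤ (t + 1) * l by positivity]
  have hZ' : (#Z : ℝ) ≤ 6 * M * #S := by exact_mod_cast hZ
  have hMS : (1 : ℝ) ≤ M * #S := one_le_mul_of_one_le_of_one_le hM1 hS1
  have hDMS : (M * #S : ℝ) ≤ D * (M * #S) := le_mul_of_one_le_left (by positivity) hD
  have hSM : (#S : ℝ) ≤ M * #S := le_mul_of_one_le_left (by positivity) hM1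
  have hnc : ∀ A : Set W, (A.ncard : ℝ) ≤ Fintype.card W := fun A => by
    rw [← Nat.card_eq_fintype_card, ← Set.ncard_univ]
    exact_mod_cast Set.ncard_le_ncard (Set.subset_univ A)
  have half : ∀ z : ι → W, Function.Injective z →
      (∀ X : Finset ι, K * #X ≤ ((outerNeighbors G ↑(X.image z)).ncard : ℝ)) →
      ∀ X ⊆ S, (#S : ℝ) ≤ 2 * #X → D * (9 * M * #S) ≤ 1 / 3 * (Fintype.card W : ℝ) ∧
        ∃ i ∈ X, 2 / 3 * (Fintype.card W : ℝ) <
          #(reach G (f ((t + 1) * l)) Z {z i} ((t + 1) * l)) := by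
    intro z hz hzN X hXS hXc
    have hXS' : (#X : ℝ) ≤ #S := by exact_mod_cast card_le_card hXS
    have hXne : X.Nonempty := card_pos.1 (by
      have : (0 : ℝ) < #X := by linarith
      exact_mod_cast this)
    have hKX : 40 * (D * (M * #S)) ≤ K * #X := by
      calc 40 * (D * (M * #S)) ≤ 40 * (D * (M * (2 * #X))) := by gcongr
        _ = 80 * D * M * #X := by ring
        _ ≤ K * #X := by gcongr
    have hN := hzN X
    have hcard : #(X.image z) = #X := card_image_of_injective _ hz
    have hn := hnc (outerNeighbors G ↑(X.image z))
    have h0 : (outerNeighbors G ↑(X.image z)).ncard ≤ #(reach G (f 0) Z (X.image z) 0) + #Z := by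
      rw [← Set.ncard_coe_finset, ← Set.ncard_coe_finset Z]
      refine le_trans (Set.ncard_le_ncard fun v hv => ?_) (Set.ncard_union_le _ _)
      by_cases hvZ : v ∈ Z
      · exact Or.inr hvZ
      · exact Or.inl (mem_coe.2 (mem_reach_zero.2 ⟨hvZ, hv.2⟩))
    have h0' : ((outerNeighbors G ↑(X.image z)).ncard : ℝ) ≤
        #(reach G (f 0) Z (X.image z) 0) + #Z := by exact_mod_cast h0
    -- The budget in units of DM|S|: the growth threshold costs at most 8 and removing Z at most 6,
    -- while at least 40 neighbours are available. These 40 also force n ≥ 40DM|S|, so that 9DM|S| ≤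
    -- n/3.
    have hsz : D * (#(X.image z) + #Z + 1) ≤ 8 * (D * (M * #S)) := by
      rw [hcard]
      calc D * (#X + #Z + 1) ≤ D * (8 * (M * #S)) := by gcongr; linarith
        _ = _ := by ring
    refine ⟨by linarith, ?_⟩
    have h1 := reach_seq_large hf hη hD hl (X.image z) Z (i := 0) (by linarith)
      (by rw [hM, add_mul]; omega)
    obtain ⟨w, hw, hwr⟩ := exists_singleton_reach hf hη hD hl Z t (X.image z)
      (hXne.image z) ((card_le_univ _).trans ht) (0 + l) (by linarith) h1
      (by rw [hM, add_mul]; omega)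
    obtain ⟨i, hi, rfl⟩ := mem_image.1 hw
    refine ⟨i, hi, ?_⟩
    rwa [show 0 + l + t * l = (t + 1) * l by ring] at hwr
  -- If the failing indices made up at least half of S, `half` would find a successful one among
  -- them.
  have few : ∀ z : ι → W, Function.Injective z →
      (∀ X : Finset ι, K * #X ≤ ((outerNeighbors G ↑(X.image z)).ncard : ℝ)) →
      (2 * #{i ∈ S | ¬ 2 / 3 * (Fintype.card W : ℝ) <
          #(reach G (f ((t + 1) * l)) Z {z i} ((t + 1) * l))} : ℝ) < #S := by
    intro z hz hzN
    by_contra! hcon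
    obtain ⟨-, i, hi, hir⟩ := half z hz hzN _ (filter_subset _ _) hcon
    exact (mem_filter.1 hi).2.not_gt hir
  have hfx := few x hx hxN
  have hfy := few y hy hyN
  obtain ⟨i, hiS, hix, hiy⟩ : ∃ i ∈ S,
      2 / 3 * (Fintype.card W : ℝ) < #(reach G (f ((t + 1) * l)) Z {x i} ((t + 1) * l)) ∧
      2 / 3 * (Fintype.card W : ℝ) < #(reach G (f ((t + 1) * l)) Z {y i} ((t + 1) * l)) := by
    by_contra! hcon
    have hsub : S ⊆ {i ∈ S | ¬ 2 / 3 * (Fintype.card W : ℝ) <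
          #(reach G (f ((t + 1) * l)) Z {x i} ((t + 1) * l))} ∪
        {i ∈ S | ¬ 2 / 3 * (Fintype.card W : ℝ) <
          #(reach G (f ((t + 1) * l)) Z {y i} ((t + 1) * l))} := by
      intro i hi
      by_cases h : 2 / 3 * (Fintype.card W : ℝ) <
          #(reach G (f ((t + 1) * l)) Z {x i} ((t + 1) * l))
      · exact mem_union_right _ (mem_filter.2 ⟨hi, not_lt.2 (hcon i hi h)⟩)
      · exact mem_union_left _ (mem_filter.2 ⟨hi, h⟩)
    have := (card_le_card hsub).trans (card_union_le _ _)
    have : (#S : ℝ) ≤ #{i ∈ S | ¬ 2 / 3 * (Fintype.card W : ℝ) <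
          #(reach G (f ((t + 1) * l)) Z {x i} ((t + 1) * l))} +
        #{i ∈ S | ¬ 2 / 3 * (Fintype.card W : ℝ) <
          #(reach G (f ((t + 1) * l)) Z {y i} ((t + 1) * l))} := by exact_mod_cast this
    linarith
  have hsmall := (half x hx hxN S subset_rfl (by linarith)).1
  obtain ⟨hsub, hstep⟩ := hf ((t + 1) * l) (by omega)
  rw [← hM, hfV] at hsub hstep
  -- Two sets of more than 2n/3 vertices share more than n/3, enough for the last random set to hit
  -- the overlap.
  obtain ⟨u, hu, huV⟩ := hstep.hit {x i} {y i} Z (by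
    have h1 : #(reach G (f ((t + 1) * l)) Z {x i} ((t + 1) * l) ∪
        reach G (f ((t + 1) * l)) Z {y i} ((t + 1) * l)) ≤ Fintype.card W := card_le_univ _
    have h2 := card_union_add_card_inter (reach G (f ((t + 1) * l)) Z {x i} ((t + 1) * l))
      (reach G (f ((t + 1) * l)) Z {y i} ((t + 1) * l))
    have h1' : (#(reach G (f ((t + 1) * l)) Z {x i} ((t + 1) * l) ∪
        reach G (f ((t + 1) * l)) Z {y i} ((t + 1) * l)) : ℝ) ≤ Fintype.card W := by
      exact_mod_cast h1
    have h2' : (#(reach G (f ((t + 1) * l)) Z {x i} ((t + 1) * l) ∪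
        reach G (f ((t + 1) * l)) Z {y i} ((t + 1) * l)) : ℝ) +
        #(reach G (f ((t + 1) * l)) Z {x i} ((t + 1) * l) ∩
        reach G (f ((t + 1) * l)) Z {y i} ((t + 1) * l)) =
        #(reach G (f ((t + 1) * l)) Z {x i} ((t + 1) * l)) +
        #(reach G (f ((t + 1) * l)) Z {y i} ((t + 1) * l)) := by exact_mod_cast h2
    have h3 : D * (#({x i} : Finset W) + #({y i} : Finset W) + #Z + 1) ≤ D * (9 * M * #S) := by
      rw [card_singleton, card_singleton]
      gcongr
      push_cast
      linarith
    linarith)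
  obtain ⟨hux, huy⟩ := mem_inter.1 hu
  obtain ⟨p, hp, hpl, hps⟩ := exists_path_of_mem_reach (reach_mono hsub _ _ _ hux)
    (reach_mono hsub _ _ _ huy) huV
  exact ⟨i, hiS, p, hp, hM ▸ hpl, hps⟩

lemma GoodChain.joinedThrough {D η K L : ℝ} {l t M : ℕ} {V : Finset W}
    (hV : GoodChain G D η M V) (hM : M = (t + 1) * l + 1) (hη : 0 ≤ η) (hD : 1 ≤ D)
    (hl : (Fintype.card W : ℝ) ≤ (1 + η / 2) ^ l) (ht : Fintype.card W ≤ 2 ^ t)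
    (hK : 80 * D * M ≤ K) (hL : 2 * (M : ℝ) ≤ L) {r : ℕ} {x y : Fin r → W}
    (hxy : Function.Injective (Sum.elim x y)) (hxV : ∀ i, x i ∉ V) (hyV : ∀ i, y i ∉ V)
    (hN : ∀ X : Set W, X ⊆ Set.range x ∪ Set.range y →
      K * (X.ncard : ℝ) ≤ ((outerNeighbors G X).ncard : ℝ)) :
    JoinedThrough G ↑V L x y := by
  classical
  have hx : Function.Injective x := hxy.comp Sum.inl_injective
  have hy : Function.Injective y := hxy.comp Sum.inr_injective
  let IsGood : (i : Fin r) → G.Walk (x i) (y i) → Prop := fun i p =>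
    p.IsPath ∧ p.length ≤ 2 * M ∧ ∀ w ∈ p.support, w = x i ∨ w = y i ∨ w ∈ V
  let Q := Σ i : Fin r, {p : G.Walk (x i) (y i) // IsGood i p}
  let inner : Q → Finset W := fun p => {v ∈ p.2.1.support.toFinset | v ∈ V}
  have hM1 : 1 ≤ M := by omega
  obtain ⟨T, hT, hTd⟩ := exists_indepTransversal (ι := Fin r) (V := Q) (cls := Sigma.fst)
    (R := fun p p' => ¬ Disjoint (inner p) (inner p'))
    (fun _ _ h => fun h' => h h'.symm) (by
      intro S hS A hA
      -- A path of length at most 2M has at most 2M + 1 ≤ 3M vertices.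
      have hZ : #(A.biUnion inner) ≤ 6 * M * #S := by
        calc #(A.biUnion inner) ≤ #A * (3 * M) := card_biUnion_le_card_mul _ _ _ fun p _ => by
              refine (card_filter_le _ _).trans ((List.toFinset_card_le _).trans ?_)
              rw [SimpleGraph.Walk.length_support]
              have := p.2.2.2.1
              omega
          _ ≤ (2 * #S) * (3 * M) := Nat.mul_le_mul_right _ (by omega)
          _ = _ := by ring
      obtain ⟨i, hi, p, hp, hpl, hps⟩ := hV.exists_path hM hη hD hl ht hK hx hy
        (fun X => by
          have := hN ↑(X.image x) (by
            rw [coe_image]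
            exact (Set.image_subset_range _ _).trans Set.subset_union_left)
          rwa [Set.ncard_coe_finset, card_image_of_injective _ hx] at this)
        (fun X => by
          have := hN ↑(X.image y) (by
            rw [coe_image]
            exact (Set.image_subset_range _ _).trans Set.subset_union_right)
          rwa [Set.ncard_coe_finset, card_image_of_injective _ hy] at this)
        S hS (A.biUnion inner) hZ
      refine ⟨⟨i, p, hp, hpl, fun w hw => (hps w hw).imp_right (Or.imp_right And.left)⟩, hi,
        fun u hu => not_not.2 (Finset.disjoint_left.2 fun w hwu hwp => ?_)⟩
      obtain ⟨hwp, hwV⟩ := mem_filter.1 hwp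
      rcases hps w (List.mem_toFinset.1 hwp) with h | h | h
      · exact hxV i (h ▸ hwV)
      · exact hyV i (h ▸ hwV)
      · exact h.2 (mem_biUnion.2 ⟨u, hu, hwu⟩))
  have hT' : ∀ i, ∃ p : {p : G.Walk (x i) (y i) // IsGood i p}, T i = ⟨i, p⟩ := by
    intro i
    have h := hT i
    generalize T i = a at h
    obtain ⟨j, p⟩ := a
    obtain rfl : j = i := h
    exact ⟨p, rfl⟩
  choose P hP using hT'
  refine ⟨fun i => (P i).1, fun i => (P i).2.1, fun i => le_trans ?_ hL, fun i v hv h1 h2 => ?_,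
    fun i j hij v hv hv' => ?_⟩
  · exact_mod_cast (P i).2.2.1
  · exact (((P i).2.2.2 v hv).resolve_left h1).resolve_left h2
  -- A common vertex in V is excluded by independence of the transversal. One outside V would be an
  -- endpoint of both paths, which distinctness of the terminals forbids.
  · by_cases hvV : v ∈ V
    · have := hTd i j hij
      rw [not_not, hP i, hP j] at this
      exact Finset.disjoint_left.1 this (mem_filter.2 ⟨List.mem_toFinset.2 hv, hvV⟩)
        (mem_filter.2 ⟨List.mem_toFinset.2 hv', hvV⟩)
    · have key : ∀ k : Fin r, v ∈ (P k).1.support → ∃ a : Fin r ⊕ Fin r,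
          Sum.elim x y a = v ∧ Sum.elim id id a = k := fun k hk => by
        rcases (P k).2.2.2 v hk with h | h | h
        · exact ⟨Sum.inl k, h.symm, rfl⟩
        · exact ⟨Sum.inr k, h.symm, rfl⟩
        · exact absurd h hvV
      obtain ⟨a, ha, hai⟩ := key i hv
      obtain ⟨b, hb, hbj⟩ := key j hv'
      have := hxy (ha.trans hb.symm)
      subst this
      exact hij (hai.symm.trans hbj)

end Connect

/-! ### Good chains occur with high probability. -/

section Probability

/-- The sum equals (1 + y)^n. A failure probability carrying a factor y for each element of X
therefore survives the union bound over all X. -/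
lemma sum_pow_card_le {W : Type*} [Fintype W] {y : ℝ} (hy : 0 ≤ y) :
    ∑ X : Finset W, y ^ #X ≤ Real.exp (Fintype.card W * y) := by
  have := Fintype.sum_pow_mul_eq_add_pow W y 1
  simp only [one_pow, mul_one] at this
  rw [this, Real.exp_nat_mul]
  exact pow_le_pow_left₀ (by linarith) (Real.add_one_le_exp y) _

variable {W : Type*} [DecidableEq W]

lemma bernProb_union {p a b : ℝ} (h : 1 - p = (1 - a) * (1 - b)) (T : Finset W)
    (P : Finset W → Prop) :
    bernProb p T P = bernExp a T (fun A => bernProb b T (fun B => P (A ∪ B))) :=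
  bernExp_union h _

lemma setBernoulli_real_eq_bernProb [Fintype W] (q : unitInterval) (P : Set W → Prop) :
    (ProbabilityTheory.setBernoulli (Set.univ : Set W) q).real {V | P V} =
      bernProb q univ (fun V : Finset W => P ↑V) := by
  classical
  have hS : {V | P V} = ⋃ V ∈ ({V : Finset W | P ↑V} : Finset (Finset W)), {(V : Set W)} := by
    ext V
    simp only [Set.mem_ofPred_eq, mem_filter, mem_univ, true_and, Set.mem_iUnion,
      Set.mem_singleton_iff, exists_prop]
    constructor
    · intro h
      exact ⟨V.toFinset, by simpa using h, by simp⟩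
    · rintro ⟨V', h, rfl⟩
      exact h
  rw [hS, MeasureTheory.measureReal_biUnion_finset]
  · unfold bernProb bernExp
    rw [powerset_univ, sum_filter]
    refine sum_congr rfl fun V _ => ?_
    beta_reduce
    by_cases h : P ↑V
    · rw [if_pos h, if_pos h, ProbabilityTheory.setBernoulli_real_singleton q (Set.subset_univ _)
        Set.finite_univ, Set.ncard_coe_finset, ← coe_univ, ← coe_sdiff, Set.ncard_coe_finset,
        mul_one]
    · rw [if_neg h, if_neg h, mul_zero]
  · intro A _ B _ hAB
    simpa [Function.onFun] using hAB
  · simp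

variable [Fintype W] {G : SimpleGraph W}

lemma reach_union_freshNeighbors_subset (A V Z X : Finset W) (k : ℕ) :
    reach G A Z X k ∪ freshNeighbors G (reach G A Z X k) Z V ⊆ reach G (A ∪ V) Z X (k + 1) := by
  intro v hv
  rcases mem_union.1 hv with hv | hv
  · exact reach_subset_succ _ _ _ _ (reach_mono subset_union_left _ _ _ hv)
  · simp only [freshNeighbors, mem_filter, mem_univ, true_and] at hv
    obtain ⟨-, hvZ, u, hu, huV, huv⟩ := hv
    exact mem_reach_succ.2 (Or.inr ⟨hvZ, u, reach_mono subset_union_left _ _ _ hu,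
      mem_union_right _ huV, huv⟩)

/-- Adding a fresh random set to `A` gives a good step with high probability. -/
lemma bernProb_not_goodStep_le {ε c s : ℝ} (hG : IsExpander G ε c s)
    {η : ℝ} (hη0 : 0 < η) (hη1 : 20 * η ≤ 1)
    (hη : 20 * η = ε / (Real.logb 2 (Fintype.card W : ℝ)) ^ c) {p : ℝ} (hp0 : 0 < p)
    (hp1 : p ≤ 1) (hps : 1 / p ≤ s) {D y : ℝ} (hD : 1 ≤ η * D) (hy : 0 ≤ y)
    (hDy : Real.exp (-(η ^ 2 * p ^ 2 / 16 * D)) ≤ y) (hny : 3 * (Fintype.card W * y) ≤ 1 / 2)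
    (k : ℕ) (A : Finset W) :
    bernProb p univ (fun V => ¬ GoodStep G D η k A (A ∪ V)) ≤ 4 * y := by
  have hD0 : 0 < D := by
    by_contra! h
    nlinarith
  set γ := η ^ 2 * p ^ 2 / 16 with hγ
  have hγ0 : 0 < γ := by positivity
  have hγp : γ ≤ p := by
    have h1 : η ^ 2 ≤ 1 := pow_le_one₀ hη0.le (by linarith)
    have h2 : η ^ 2 * p ^ 2 ≤ 1 * p ^ 2 := by gcongr
    nlinarith
  -- Each D vertices of a reached set buy one factor y; this is why the thresholds in `GoodStep` are
  -- D times the total size of the sets plus one.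
  have hexp : ∀ (m : ℕ) (R : Finset W), D * m ≤ #R → Real.exp (-(γ * #R)) ≤ y ^ m := by
    intro m R h
    refine le_trans ?_ (pow_le_pow_left₀ (Real.exp_pos _).le hDy m)
    rw [← Real.exp_nat_mul, Real.exp_le_exp]
    nlinarith
  have hhalf : Real.exp (1 / 2) ≤ 2 := by
    have h1 : Real.exp (1 / 2) ^ 2 ≤ 2 ^ 2 := by
      rw [← Real.exp_nat_mul]
      norm_num
      linarith [Real.exp_one_lt_d9]
    exact le_of_sq_le_sq h1 (by norm_num)
  set P₁ : Finset W × Finset W → Finset W → Prop := fun a V =>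
    D * (#a.1 + #a.2 + 1) ≤ #(reach G A a.2 a.1 k) ∧
    (#(reach G A a.2 a.1 k) : ℝ) ≤ 2 / 3 * (Fintype.card W : ℝ) ∧
    (#(freshNeighbors G (reach G A a.2 a.1 k) a.2 V) : ℝ) < η / 2 * #(reach G A a.2 a.1 k) with hP₁
  set P₂ : Finset W × Finset W × Finset W → Finset W → Prop := fun a V =>
    D * (#a.1 + #a.2.1 + #a.2.2 + 1) ≤ #(reach G A a.2.2 a.1 k ∩ reach G A a.2.2 a.2.1 k) ∧
    Disjoint (reach G A a.2.2 a.1 k ∩ reach G A a.2.2 a.2.1 k) V with hP₂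
  have h1 : ∀ a, bernProb p univ (P₁ a) ≤ y * (y ^ #a.1 * y ^ #a.2) := by
    intro a
    by_cases h : D * (#a.1 + #a.2 + 1) ≤ #(reach G A a.2 a.1 k) ∧
        (#(reach G A a.2 a.1 k) : ℝ) ≤ 2 / 3 * (Fintype.card W : ℝ)
    · have hR1 : (0 : ℝ) < #(reach G A a.2 a.1 k) := lt_of_lt_of_le (by positivity) h.1
      have hZ : (#a.2 : ℝ) ≤ η * #(reach G A a.2 a.1 k) := by
        calc (#a.2 : ℝ) ≤ (η * D) * (#a.1 + #a.2 + 1) := by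
              have : (0 : ℝ) ≤ #a.1 + #a.2 + 1 := by positivity
              nlinarith [show (0 : ℝ) ≤ #a.1 by positivity]
          _ = η * (D * (#a.1 + #a.2 + 1)) := by ring
          _ ≤ _ := by gcongr; exact h.1
      calc bernProb p univ (P₁ a) ≤ _ := bernProb_mono hp0.le hp1 fun V hV => hV.2.2
        _ ≤ _ := bernProb_freshNeighbors_lt hG hη0 hη1 hη hp0 hp1 hps _ a.2
            (card_pos.1 (by exact_mod_cast hR1)) h.2 hZ
        _ ≤ y ^ (#a.1 + #a.2 + 1) := hexp _ _ (by exact_mod_cast h.1)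
        _ = _ := by ring
    · have : P₁ a = fun _ => False := by
        ext V
        simp only [hP₁, iff_false]
        exact fun h' => h ⟨h'.1, h'.2.1⟩
      rw [this]
      have : bernProb p (univ : Finset W) (fun _ => False) = 0 := by simp [bernProb, bernExp_const]
      rw [this]
      positivity
  have h2 : ∀ a, bernProb p univ (P₂ a) ≤ y * (y ^ #a.1 * (y ^ #a.2.1 * y ^ #a.2.2)) := by
    intro a
    by_cases h : D * (#a.1 + #a.2.1 + #a.2.2 + 1) ≤
        #(reach G A a.2.2 a.1 k ∩ reach G A a.2.2 a.2.1 k)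
    · calc bernProb p univ (P₂ a) ≤ _ := bernProb_mono hp0.le hp1 fun V hV => hV.2
        _ = _ := bernProb_disjoint _
        _ ≤ Real.exp (-p) ^ #(univ ∩ (reach G A a.2.2 a.1 k ∩ reach G A a.2.2 a.2.1 k)) :=
            pow_le_pow_left₀ (by linarith) (by linarith [Real.add_one_le_exp (-p)]) _
        _ ≤ Real.exp (-(γ * #(reach G A a.2.2 a.1 k ∩ reach G A a.2.2 a.2.1 k))) := by
            rw [univ_inter, ← Real.exp_nat_mul, Real.exp_le_exp]
            have : (0 : ℝ) ≤ #(reach G A a.2.2 a.1 k ∩ reach G A a.2.2 a.2.1 k) := by positivity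
            nlinarith
        _ ≤ y ^ (#a.1 + #a.2.1 + #a.2.2 + 1) := hexp _ _ (by exact_mod_cast h)
        _ = _ := by ring
    · have : P₂ a = fun _ => False := by
        ext V
        simp only [hP₂, iff_false]
        exact fun h' => h h'.1
      rw [this]
      have : bernProb p (univ : Finset W) (fun _ => False) = 0 := by simp [bernProb, bernExp_const]
      rw [this]
      positivity
  have hs0 : (0 : ℝ) ≤ ∑ X : Finset W, y ^ #X := sum_nonneg fun X _ => by positivity
  have hs := sum_pow_card_le (W := W) hy
  have hny0 : 0 ≤ (Fintype.card W : ℝ) * y := by positivity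
  have hsum1 : ∑ a : Finset W × Finset W, y * (y ^ #a.1 * y ^ #a.2) ≤ 2 * y := by
    rw [← mul_sum, Fintype.sum_prod_type]
    simp only [← mul_sum, ← sum_mul]
    calc y * ((∑ X : Finset W, y ^ #X) * ∑ X : Finset W, y ^ #X)
        ≤ y * (Real.exp (Fintype.card W * y) * Real.exp (Fintype.card W * y)) := by gcongr
      _ ≤ y * 2 := by
          gcongr
          rw [← Real.exp_add]
          exact (Real.exp_le_exp.2 (by linarith)).trans hhalf
      _ = _ := by ring
  have hsum2 : ∑ a : Finset W × Finset W × Finset W,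
      y * (y ^ #a.1 * (y ^ #a.2.1 * y ^ #a.2.2)) ≤ 2 * y := by
    rw [← mul_sum, Fintype.sum_prod_type]
    simp only [Fintype.sum_prod_type, ← mul_sum, ← sum_mul]
    calc y * ((∑ X : Finset W, y ^ #X) * ((∑ X : Finset W, y ^ #X) * ∑ X : Finset W, y ^ #X))
        ≤ y * (Real.exp (Fintype.card W * y) *
          (Real.exp (Fintype.card W * y) * Real.exp (Fintype.card W * y))) := by gcongr
      _ ≤ y * 2 := by
          gcongr
          rw [← Real.exp_add, ← Real.exp_add]
          exact (Real.exp_le_exp.2 (by linarith)).trans hhalf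
      _ = _ := by ring
  calc bernProb p univ (fun V => ¬ GoodStep G D η k A (A ∪ V))
      ≤ bernProb p univ (fun V => (∃ a ∈ univ, P₁ a V) ∨ ∃ a ∈ univ, P₂ a V) := by
        refine bernProb_mono hp0.le hp1 fun V hV => ?_
        contrapose! hV
        refine ⟨fun X Z hX hXn => ?_, fun X Y Z hXY => ?_⟩
        · have hnot := hV.1 (X, Z) (mem_univ _)
          have hge : η / 2 * #(reach G A Z X k) ≤
              (#(freshNeighbors G (reach G A Z X k) Z V) : ℝ) := by
            by_contra! hlt
            exact hnot ⟨hX, hXn, hlt⟩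
          have hsub := card_le_card (reach_union_freshNeighbors_subset (G := G) A V Z X k)
          rw [card_union_of_disjoint] at hsub
          · have : (#(reach G A Z X k) : ℝ) + #(freshNeighbors G (reach G A Z X k) Z V) ≤
                #(reach G (A ∪ V) Z X (k + 1)) := by exact_mod_cast hsub
            linarith
          · rw [Finset.disjoint_left]
            intro v hv hv'
            simp only [freshNeighbors, mem_filter] at hv'
            exact hv'.2.1 hv
        · have hnot := hV.2 (X, Y, Z) (mem_univ _)
          by_contra! hcon
          exact hnot ⟨hXY, Finset.disjoint_left.2 fun u hu huV =>
            hcon u hu (mem_union_right _ huV)⟩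
    _ ≤ _ := bernProb_or_le hp0.le hp1 _ _
    _ ≤ 2 * y + 2 * y := add_le_add
        ((bernProb_exists_le hp0.le hp1 univ P₁).trans ((sum_le_sum fun a _ => h1 a).trans hsum1))
        ((bernProb_exists_le hp0.le hp1 univ P₂).trans ((sum_le_sum fun a _ => h2 a).trans hsum2))
    _ = _ := by ring

/-- Split off the last p-random set: either the union A of the earlier ones fails to end a good
chain, or the step from A fails. The step bound is uniform in A, so each round adds δ. -/
lemma bernProb_not_goodChain_le {D η p δ : ℝ} (hp0 : 0 ≤ p) (hp1 : p ≤ 1)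
    (hstep : ∀ k A, bernProb p univ (fun V => ¬ GoodStep G D η k A (A ∪ V)) ≤ δ)
    (k : ℕ) {q : ℝ} (hq : 1 - q = (1 - p) ^ k) :
    bernProb q univ (fun V => ¬ GoodChain G D η k V) ≤ k * δ := by
  induction k generalizing q with
  | zero => simp [GoodChain, bernProb, bernExp_const]
  | succ k ih =>
    have h1p : 0 ≤ 1 - p := by linarith
    set a := 1 - (1 - p) ^ k with ha
    have ha0 : 0 ≤ a := by
      have := pow_le_one₀ (n := k) h1p (by linarith : 1 - p ≤ 1)
      linarith
    have ha1 : a ≤ 1 := by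
      have : 0 ≤ (1 - p) ^ k := by positivity
      linarith
    rw [bernProb_union (a := a) (b := p) (by rw [hq, pow_succ, ha]; ring)]
    have hA : ∀ A, bernProb p univ (fun V => ¬ GoodChain G D η (k + 1) (A ∪ V)) ≤
        @ite ℝ (¬ GoodChain G D η k A) (Classical.propDecidable _) 1 0 + δ := by
      intro A
      have hδ : 0 ≤ δ := by
        refine le_trans ?_ (hstep k A)
        have : bernProb p (univ : Finset W) (fun _ => False) = 0 := by
          simp [bernProb, bernExp_const]
        rw [← this]
        exact bernProb_mono hp0 hp1 fun _ h => h.elim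
      by_cases h : GoodChain G D η k A
      · rw [if_neg (not_not.2 h), zero_add]
        refine (bernProb_mono hp0 hp1 fun V hV => ?_).trans (hstep k A)
        exact fun hs => hV ⟨A, subset_union_left, h, hs⟩
      · rw [if_pos h]
        exact (bernProb_le_one hp0 hp1 _).trans (by linarith)
    refine (bernExp_mono ha0 ha1 hA).trans ?_
    rw [bernExp_add, bernExp_const]
    refine (add_le_add_left (ih (q := a) (by rw [ha]; ring)) δ).trans (le_of_eq ?_)
    push_cast
    ring

end Probability

/-! ### Choice of parameters. -/

lemma exists_root_probability {q : ℝ} (hq0 : 0 < q) (hq1 : q < 1) {M : ℕ} (hM : 1 ≤ M) :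
    ∃ p : ℝ, 0 < p ∧ p ≤ 1 ∧ q / M ≤ p ∧ 1 - q = (1 - p) ^ M := by
  have hM0 : (0 : ℝ) < M := by exact_mod_cast hM
  have hM1 : (1 : ℝ) ≤ M := by exact_mod_cast hM
  have h1q : 0 ≤ 1 - q := by linarith
  set b := (1 - q) ^ ((M : ℝ)⁻¹) with hb
  have hb0 : 0 ≤ b := Real.rpow_nonneg h1q _
  have hbM : b ^ M = 1 - q := Real.rpow_inv_natCast_pow h1q (by omega)
  have hqM : q / M ≤ 1 := by rw [div_le_one hM0]; linarith
  -- Bernoulli's inequality gives (1 - q/M)^M ≥ 1 - q = b^M.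
  have hle : b ≤ 1 - q / M := by
    rw [← pow_le_pow_iff_left₀ hb0 (by linarith) (by omega : M ≠ 0), hbM]
    have := one_add_mul_le_pow (a := -(q / M)) (by linarith) M
    have h2 : (M : ℝ) * (q / M) = q := by field_simp
    rw [← sub_eq_add_neg] at this
    linarith
  have hpos : 0 < q / M := by positivity
  exact ⟨1 - b, by linarith, by linarith, by linarith, by rw [sub_sub_cancel, hbM]⟩

lemma exp_neg_mul_rpow_pow_le_one {x : ℝ} (hx : 0 ≤ x) :
    Real.exp (-(3 * x)) * ((2 : ℝ) ^ x) ^ 3 ≤ 1 := by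
  have h1 : (2 : ℝ) ^ x ≤ Real.exp x := by
    calc (2 : ℝ) ^ x ≤ Real.exp 1 ^ x :=
          Real.rpow_le_rpow (by norm_num) (by linarith [Real.add_one_le_exp 1]) hx
      _ = _ := by rw [← Real.exp_mul, one_mul]
  calc Real.exp (-(3 * x)) * ((2 : ℝ) ^ x) ^ 3 ≤ Real.exp (-(3 * x)) * Real.exp x ^ 3 := by gcongr
    _ = 1 := by
      rw [← Real.exp_nat_mul, ← Real.exp_add, Real.exp_eq_one_iff]
      push_cast
      ring

/-- The number of rounds needed to grow a set by the factor `1 + η / 2` in each round until it has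
`2 ^ x` elements, `log n + 1` times in a row. -/
lemma exists_round_count {η x A : ℝ} (hη0 : 0 < η) (hη1 : 20 * η ≤ 1) (hηA : 1 / η ≤ 10240 * A)
    (hA1 : 1 ≤ A) (hx0 : 200000 ≤ x) :
    ∃ l t : ℕ, (2 : ℝ) ^ x ≤ (1 + η / 2) ^ l ∧ (2 : ℝ) ^ x ≤ 2 ^ t ∧
      (((t + 1) * l + 1 : ℕ) : ℝ) ≤ A * x ^ 3 := by
  have hx1 : 1 ≤ x := by linarith
  -- k rounds double a set, and t ≥ x doublings exceed 2^x; hence l = kt.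
  obtain ⟨k, hk⟩ : ∃ k : ℕ, k = ⌈2 / η⌉₊ := ⟨_, rfl⟩
  obtain ⟨t, ht⟩ : ∃ t : ℕ, t = ⌈x⌉₊ := ⟨_, rfl⟩
  have hk1 : 2 / η ≤ k := hk ▸ Nat.le_ceil _
  have hk2 : (k : ℝ) ≤ 20481 * A := by
    have := (Nat.ceil_lt_add_one (by positivity : 0 ≤ 2 / η)).le
    rw [← hk] at this
    have h2 : 2 / η = 2 * (1 / η) := by ring
    linarith
  have ht1 : x ≤ t := ht ▸ Nat.le_ceil _
  have ht2 : (t : ℝ) ≤ 2 * x := by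
    have := (Nat.ceil_lt_add_one (by linarith : 0 ≤ x)).le
    rw [← ht] at this
    linarith
  have hn2t : (2 : ℝ) ^ x ≤ 2 ^ t := by
    rw [← Real.rpow_natCast]
    exact Real.rpow_le_rpow_of_exponent_le (by norm_num) ht1
  have hkpow : 2 ≤ (1 + η / 2) ^ k := by
    have := one_add_mul_le_pow (a := η / 2) (by linarith) k
    rw [div_le_iff₀ hη0] at hk1
    linarith
  refine ⟨k * t, t, hn2t.trans ?_, hn2t, ?_⟩
  · rw [pow_mul]
    gcongr
  · have h2 : ((t : ℝ) + 1) * (k * t) ≤ (3 * x) * ((20481 * A) * (2 * x)) := by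
      gcongr
      linarith
    have h3 : 1 ≤ A * x ^ 2 := one_le_mul_of_one_le_of_one_le hA1 (one_le_pow₀ hx1)
    have h4 : 200000 * (A * x ^ 2) ≤ x * (A * x ^ 2) := by gcongr
    push_cast
    linarith

/-- The expansion `100 (log n) ^ (7 c + 19) / q ^ 6` of the terminals is large enough. -/
lemma eighty_mul_le {η x A p q M : ℝ} (hη0 : 0 < η) (hηA : 1 / η ≤ 10240 * A) (hA1 : 1 ≤ A)
    (hx0 : 200000 ≤ x) (hp0 : 0 < p) (hq0 : 0 < q) (hq1 : q ≤ 1)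
    (hpinv : 1 / p ≤ A * x ^ 3 / q) (hM0 : 0 ≤ M) (hM : M ≤ A * x ^ 3) :
    80 * (48 * x / (η ^ 2 * p ^ 2)) * M ≤ 100 * (A ^ 7 * x ^ 19) / q ^ 6 := by
  have hD : 48 * x / (η ^ 2 * p ^ 2) ≤ 48 * 10240 ^ 2 * (A ^ 4 * x ^ 7) / q ^ 2 := by
    have : 48 * x / (η ^ 2 * p ^ 2) = 48 * x * (1 / η) ^ 2 * (1 / p) ^ 2 := by field_simp
    rw [this]
    calc 48 * x * (1 / η) ^ 2 * (1 / p) ^ 2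
        ≤ 48 * x * (10240 * A) ^ 2 * (A * x ^ 3 / q) ^ 2 := by gcongr
      _ = _ := by field_simp
  calc 80 * (48 * x / (η ^ 2 * p ^ 2)) * M
      ≤ 80 * (48 * 10240 ^ 2 * (A ^ 4 * x ^ 7) / q ^ 2) * (A * x ^ 3) := by
        gcongr
    _ = (80 * 48 * 10240 ^ 2) * (A ^ 5 * x ^ 10) / q ^ 2 := by ring
    _ ≤ 100 * (A ^ 7 * x ^ 19) / q ^ 6 := by
        refine div_le_div₀ (by positivity) ?_ (by positivity)
          (pow_le_pow_of_le_one hq0.le hq1 (by norm_num))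
        -- The numerical constants are absorbed by the spare factor x^9.
        have h1 : (200000 : ℝ) ^ 9 ≤ x ^ 9 := by gcongr
        have h2 : A ^ 5 ≤ A ^ 7 := pow_le_pow_right₀ hA1 (by norm_num)
        calc (80 * 48 * 10240 ^ 2) * (A ^ 5 * x ^ 10)
            ≤ (100 * 200000 ^ 9) * (A ^ 5 * x ^ 10) :=
              mul_le_mul_of_nonneg_right (by norm_num) (by positivity)
          _ ≤ (100 * x ^ 9) * (A ^ 7 * x ^ 10) := by gcongr
          _ = _ := by ring

lemma mul_pow_three_le {A x : ℝ} (hA1 : 1 ≤ A) (hx1 : 1 ≤ x) {a b : ℕ} (ha : 1 ≤ a) (hb : 3 ≤ b) :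
    A * x ^ 3 ≤ A ^ a * x ^ b :=
  mul_le_mul (le_self_pow₀ hA1 (by omega)) (pow_le_pow_right₀ hx1 hb) (by positivity)
    (by positivity)

/-- With high probability the random set is the end of a good chain, whose parameters are
controlled by the expansion and by `x = log n` and `A = (log n) ^ c`. -/
lemma exists_goodChain_parameters {W : Type*} [DecidableEq W] [Fintype W] {G : SimpleGraph W}
    {ε c s q x A : ℝ}
    (hx : x = Real.logb 2 (Fintype.card W : ℝ)) (hA : A = x ^ c) (hA1 : 1 ≤ A)
    (hx0 : 200000 ≤ x) (hn : 4 ≤ Fintype.card W)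
    (hε0 : 1 / 512 ≤ ε) (hε1 : ε < 1) (hq0 : 0 < q) (hq1 : q < 1)
    (hs : 2 * (A ^ 9 * x ^ 21) / q ^ 10 ≤ s) (hG : IsExpander G ε c s)
    (hK : 100 * (A ^ 7 * x ^ 19) / q ^ 6 ≤ Fintype.card W) :
    ∃ (D η : ℝ) (l t M : ℕ), M = (t + 1) * l + 1 ∧ 0 ≤ η ∧ 1 ≤ D ∧
      (Fintype.card W : ℝ) ≤ (1 + η / 2) ^ l ∧ Fintype.card W ≤ 2 ^ t ∧
      80 * D * M ≤ 100 * (A ^ 7 * x ^ 19) / q ^ 6 ∧ 2 * (M : ℝ) ≤ A * x ^ 4 ∧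
      bernProb q univ (fun V => ¬ GoodChain G D η M V) ≤ 1 / (Fintype.card W : ℝ) := by
  have hn4 : (4 : ℝ) ≤ Fintype.card W := by exact_mod_cast hn
  have hx1 : 1 ≤ x := by linarith
  have hnx : (Fintype.card W : ℝ) = 2 ^ x := by
    rw [hx, Real.rpow_logb (by norm_num) (by norm_num) (by linarith)]
  -- Expansion is written as 20η; the lower bound on ε gives 1/η ≤ 20 · 512 · A.
  obtain ⟨η, hη⟩ : ∃ η, η = ε / (20 * A) := ⟨_, rfl⟩
  have hη0 : 0 < η := by rw [hη]; positivity
  have hη20 : 20 * η = ε / A := by rw [hη]; field_simp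
  have hη1 : 20 * η ≤ 1 := by rw [hη20, div_le_one (by linarith)]; linarith
  have hηinv : 1 / η ≤ 10240 * A := by
    rw [hη, one_div_div, div_le_iff₀ (by linarith)]
    nlinarith
  obtain ⟨l, t, hl, ht, hMle⟩ := exists_round_count hη0 hη1 hηinv hA1 hx0
  rw [← hnx] at hl ht
  -- l rounds for the initial growth, l for each of t halvings, and one to hit the overlap.
  obtain ⟨M, hM⟩ : ∃ M : ℕ, M = (t + 1) * l + 1 := ⟨_, rfl⟩
  rw [← hM] at hMle
  have hM1 : 1 ≤ M := by omega
  have hM1' : (1 : ℝ) ≤ M := by exact_mod_cast hM1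
  obtain ⟨p, hp0, hp1, hpq, hqp⟩ := exists_root_probability hq0 hq1 hM1
  have hAx : 0 ≤ A * x ^ 3 := by positivity
  have hpinv : 1 / p ≤ A * x ^ 3 / q := by
    rw [one_div_le hp0 (by positivity), one_div_div]
    refine le_trans ?_ hpq
    gcongr
  have hps : 1 / p ≤ s := by
    refine hpinv.trans (le_trans ?_ hs)
    have h1 : q ^ 10 ≤ q := pow_le_of_le_one hq0.le hq1.le (by norm_num)
    have h2 := mul_pow_three_le hA1 hx1 (a := 9) (b := 21) (by norm_num) (by norm_num)
    exact div_le_div₀ (by positivity) (by linarith) (by positivity) h1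
  -- Chosen so that η²p²D/16 = 3x; then y = exp(-3x) ≤ n^(-3), and the total failure probability 4My
  -- is at most 1/n because M ≤ n.
  obtain ⟨D, hD⟩ : ∃ D, D = 48 * x / (η ^ 2 * p ^ 2) := ⟨_, rfl⟩
  have hηp : η ^ 2 * p ^ 2 ≤ η := by
    have h1 : p ^ 2 ≤ 1 := pow_le_one₀ hp0.le hp1
    nlinarith
  have hηD : 1 ≤ η * D := by
    rw [hD, ← mul_div_assoc, le_div_iff₀ (by positivity)]
    nlinarith
  have hD1 : 1 ≤ D := by
    have hD0 : 0 ≤ D := by rw [hD]; positivity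
    nlinarith
  obtain ⟨y, hy⟩ : ∃ y, y = Real.exp (-(3 * x)) := ⟨_, rfl⟩
  have hy0 : 0 < y := hy ▸ Real.exp_pos _
  have hyn : y * (Fintype.card W : ℝ) ^ 3 ≤ 1 := by
    rw [hy, hnx]
    exact exp_neg_mul_rpow_pow_le_one (by linarith)
  have hny : 3 * ((Fintype.card W : ℝ) * y) ≤ 1 / 2 := by
    generalize (Fintype.card W : ℝ) = n at hn4 hyn
    have h2 : (n * y) * 16 ≤ (n * y) * n ^ 2 :=
      mul_le_mul_of_nonneg_left (by nlinarith) (by positivity)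
    have h3 : (n * y) * n ^ 2 = y * n ^ 3 := by ring
    linarith
  have hDy : Real.exp (-(η ^ 2 * p ^ 2 / 16 * D)) ≤ y := by
    have : η ^ 2 * p ^ 2 / 16 * D = 3 * x := by rw [hD]; field_simp; norm_num
    rw [this, hy]
  have hstep := bernProb_not_goodStep_le hG hη0 hη1 (by rw [hη20, hA, hx]) hp0 hp1 hps hηD hy0.le
    hDy hny
  have hchain := bernProb_not_goodChain_le (G := G) hp0.le hp1 hstep M hqp
  have hMn : (M : ℝ) ≤ Fintype.card W := by
    refine hMle.trans (le_trans ?_ hK)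
    rw [le_div_iff₀ (by positivity)]
    have h1 : q ^ 6 ≤ 1 := pow_le_one₀ hq0.le hq1.le
    have h2 := mul_pow_three_le hA1 hx1 (a := 7) (b := 19) (by norm_num) (by norm_num)
    have h3 := mul_le_of_le_one_right hAx h1
    linarith
  refine ⟨D, η, l, t, M, hM, hη0.le, hD1, hl, by exact_mod_cast ht, ?_, ?_, ?_⟩
  · rw [hD]
    exact eighty_mul_le hη0 hηinv hA1 hx0 hp0 hq0 hq1.le hpinv (by linarith) hMle
  · have h1 : 2 * (A * x ^ 3) ≤ x * (A * x ^ 3) := by gcongr; linarith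
    have h2 : x * (A * x ^ 3) = A * x ^ 4 := by ring
    linarith
  · refine hchain.trans ?_
    rw [le_div_iff₀ (by linarith)]
    generalize (Fintype.card W : ℝ) = n at hn4 hyn hMn
    calc (M : ℝ) * (4 * y) * n ≤ n * (4 * y) * n := by gcongr
      _ = y * (n * n * 4) := by ring
      _ ≤ y * (n * n * n) := by gcongr
      _ = y * n ^ 3 := by ring
      _ ≤ 1 := hyn

lemma exists_forall_le_logb (C : ℝ) :
    ∃ n₀ : ℕ, ∀ n : ℕ, n₀ ≤ n → C ≤ Real.logb 2 (n : ℝ) :=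
  Filter.eventually_atTop.1 (((Real.tendsto_logb_atTop (by norm_num)).comp
    tendsto_natCast_atTop_atTop).eventually_ge_atTop C)

end SublinearExpander

theorem mainTheorem4 :
    ∃ n₀ : ℕ, ∀ (W : Type*) [Fintype W] (G : SimpleGraph W) (ε c s : ℝ) (q : unitInterval),
      n₀ ≤ Fintype.card W →
      (2 : ℝ) ^ (-9 : ℤ) ≤ ε → ε < 1 → 0 < c → 0 < (q : ℝ) → (q : ℝ) < 1 →
      2 * (Real.logb 2 (Fintype.card W : ℝ)) ^ (9 * c + 21) / (q : ℝ) ^ 10 ≤ s →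
      SublinearExpander.IsExpander G ε c s →
      1 - 1 / (Fintype.card W : ℝ) ≤
        (ProbabilityTheory.setBernoulli (Set.univ : Set W) q).real
          {V : Set W | ∀ (r : ℕ) (x y : Fin r → W),
            Function.Injective (Sum.elim x y) →
            (∀ i, x i ∉ V) → (∀ i, y i ∉ V) →
            (∀ X : Set W, X ⊆ Set.range x ∪ Set.range y →
              100 * (Real.logb 2 (Fintype.card W : ℝ)) ^ (7 * c + 19) / (q : ℝ) ^ 6 *
                  (X.ncard : ℝ) ≤
                ((SublinearExpander.outerNeighbors G X).ncard : ℝ)) →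
            SublinearExpander.JoinedThrough G V
              ((Real.logb 2 (Fintype.card W : ℝ)) ^ (c + 4)) x y} := by
  classical
  obtain ⟨n₀, hn₀⟩ := SublinearExpander.exists_forall_le_logb 200000
  refine ⟨max n₀ 4, fun W _ G ε c s q hn hε0 hε1 hc hq0 hq1 hs hG => ?_⟩
  have hx0 := hn₀ _ ((le_max_left _ _).trans hn)
  have hn4 := (le_max_right _ _).trans hn
  set x := Real.logb 2 (Fintype.card W : ℝ) with hx
  have hx1 : 1 ≤ x := by linarith
  have hrpow : ∀ a b : ℕ, x ^ (a * c + b) = (x ^ c) ^ a * x ^ b := fun a b => by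
    rw [Real.rpow_add (by linarith), Real.rpow_natCast, mul_comm (a : ℝ) c,
      Real.rpow_mul (by linarith), Real.rpow_natCast]
  have h4 : x ^ (c + 4) = x ^ c * x ^ 4 := by simpa using hrpow 1 4
  have h19 : x ^ (7 * c + 19) = (x ^ c) ^ 7 * x ^ 19 := by simpa using hrpow 7 19
  have h21 : x ^ (9 * c + 21) = (x ^ c) ^ 9 * x ^ 21 := by simpa using hrpow 9 21
  rw [h21] at hs
  rw [h4, h19]
  have hn0 : (0 : ℝ) < Fintype.card W := by exact_mod_cast (by omega : 0 < Fintype.card W)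
  -- If the required expansion exceeds n, no single terminal can satisfy it, so r = 0 and the claim
  -- is trivial. Otherwise this bound yields M ≤ n.
  by_cases hK : 100 * ((x ^ c) ^ 7 * x ^ 19) / (q : ℝ) ^ 6 ≤ Fintype.card W
  · obtain ⟨D, η, l, t, M, hM, hη, hD, hl, ht, hDK, hL, hprob⟩ :=
      SublinearExpander.exists_goodChain_parameters hx rfl (Real.one_le_rpow hx1 hc.le) hx0 hn4
        (le_trans (by norm_num) hε0) hε1 hq0 hq1 hs hG hK
    rw [SublinearExpander.setBernoulli_real_eq_bernProb]
    rw [SublinearExpander.bernProb_not] at hprob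
    refine le_trans (by linarith) (SublinearExpander.bernProb_mono hq0.le hq1.le (P := fun V =>
      SublinearExpander.GoodChain G D η M V) fun V hV r a b hab ha hb hN => ?_)
    exact hV.joinedThrough hM hη hD hl ht hDK hL hab ha hb hN
  · have huniv : ∀ S : Set (Set W), (∀ V, V ∈ S) →
        1 - 1 / (Fintype.card W : ℝ) ≤
          (ProbabilityTheory.setBernoulli (Set.univ : Set W) q).real S := fun S hS => by
      rw [Set.eq_univ_of_forall hS, MeasureTheory.probReal_univ]
      have : 0 < 1 / (Fintype.card W : ℝ) := by positivity
      linarith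
    refine huniv _ fun V r a b hab ha hb hN => ?_
    rcases r with _ | r
    · exact ⟨fun i => i.elim0, fun i => i.elim0, fun i => i.elim0, fun i => i.elim0,
        fun i => i.elim0⟩
    · exfalso
      have h1 := hN {a 0} (Set.singleton_subset_iff.2 (Or.inl ⟨0, rfl⟩))
      rw [Set.ncard_singleton, Nat.cast_one, mul_one] at h1
      have h2 : ((SublinearExpander.outerNeighbors G {a 0}).ncard : ℝ) ≤ Fintype.card W := by
        rw [← Nat.card_eq_fintype_card, ← Set.ncard_univ]
        exact_mod_cast Set.ncard_le_ncard (Set.subset_univ _)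
      exact hK (h1.trans h2)
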